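/- Let $l\ge 1$ and let $\{P_0,P_1\}$ be a symmetric Clifford system on $\mathbb{R}^{2l}$, i.e. $P_0,P_1$ are real symmetric $2l\times 2l$ matrices with $P_iP_j+P_jP_i=2\delta_{ij}I_{2l}$. Let $F(x)=|x|^4-2\sum_{i=0}^{1}\langle P_ix,x\rangle^2$, let $f=F|_{S^{2l-1}}$, and let $M_+=f^{-1}(1)\subset S^{2l-1}$ be the focal submanifold (the OT-FKM case $m=1$), a smooth submanifold of $\mathbb{R}^{2l}$ of dimension $2l-3$ (empty if $l=1$). On $N=S^1\times M_+$, where $S^1\subset\mathbb{C}$ is the unit circle, put $\varepsilon(a)=\sqrt{-1}\,a\in T_aS^1$ and $\eta(x)=P_0P_1x$, and let $V$ be the orthogonal complement of $\eta(x)$ in $T_xM_+$. Then there is exactly one field $J$ of endomorphisms of $TN$ with $$J\varepsilon=\eta,\qquad J\eta=-\varepsilon,\qquad JX=P_0P_1X\quad (X\in V).$$ This $J$ is a smooth almost complex structure ($J^2=-\mathrm{id}$), and it is integrable: $N$ carries the structure of a complex manifold of complex dimension $l-1$, compatible with its smooth structure, for which $J$ is multiplication by $\sqrt{-1}$ on tangent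 spaces. Furthermore, with $ds^2$ the product of the metrics on $S^1$ and $M_+$ induced from $\mathbb{C}$ and $\mathbb{R}^{2l}$, $(N,J,ds^2)$ is a Hermitian manifold, i.e. in addition $ds^2$ is a smooth Riemannian metric with $ds^2(Ju,Jv)=ds^2(u,v)$ for all tangent vectors $u,v$ at the same point. -/

import Mathlib

open scoped Manifold ContDiff Topology

noncomputable section

/-! ### Regular zero sets as smooth manifolds -/

namespace RegularZeroSet

section

variable {E F K : Type*} [NormedAddCommGroup E] [NormedAddCommGroup F] [NormedAddCommGroup K]

open Classical in
/-- A local homeomorphism of the ambient space that sends `Z` into the slice `{0} × K` restricts to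
a chart of `Z` with values in `K`. -/
def sliceChart (Z : Set E) (e : OpenPartialHomeomorph E (F × K))
    (h : ∀ y ∈ e.source, y ∈ Z ↔ (e y).1 = 0) (z : Z) :
    OpenPartialHomeomorph Z K :=
  { toFun := fun y => (e y).2
    invFun := fun k => if hk : ((0, k) : F × K) ∈ e.target then
        ⟨e.symm (0, k), (h _ (e.map_target hk)).2 (by rw [e.right_inv hk])⟩ else z
    source := {y | (y : E) ∈ e.source}
    target := {k | ((0, k) : F × K) ∈ e.target}
    map_source' := by
      intro y hy
      have h0 : (e y).1 = 0 := (h _ hy).1 y.2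
      have : ((0, (e y).2) : F × K) = e y := Prod.ext h0.symm rfl
      simpa only [Set.mem_ofPred_eq, this] using e.map_source hy
    map_target' := by
      intro k hk
      have hk' : ((0, k) : F × K) ∈ e.target := hk
      simpa only [Set.mem_ofPred_eq, dif_pos hk'] using e.map_target hk'
    left_inv' := by
      intro y hy
      have h0 : (e y).1 = 0 := (h _ hy).1 y.2
      have h1 : ((0, (e y).2) : F × K) = e y := Prod.ext h0.symm rfl
      have h2 : ((0, (e y).2) : F × K) ∈ e.target := h1 ▸ e.map_source hy
      apply Subtype.ext
      simp only [dif_pos h2]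
      rw [h1, e.left_inv hy]
    right_inv' := by
      intro k hk
      have hk' : ((0, k) : F × K) ∈ e.target := hk
      simp only [dif_pos hk']
      rw [e.right_inv hk']
    open_source := e.open_source.preimage continuous_subtype_val
    open_target := e.open_target.preimage (by fun_prop)
    continuousOn_toFun := by
      exact continuous_snd.comp_continuousOn
        (e.continuousOn.comp continuous_subtype_val.continuousOn fun y hy => hy)
    continuousOn_invFun := by
      rw [Topology.IsInducing.subtypeVal.continuousOn_iff]
      refine ContinuousOn.congr (f := fun k : K => e.symm ((0, k) : F × K)) ?_ ?_
      · exact e.continuousOn_symm.comp (by fun_prop) fun k hk => hk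
      · intro k hk
        have hk' : ((0, k) : F × K) ∈ e.target := hk
        simp only [Function.comp_apply, dif_pos hk'] }

open Classical in
theorem sliceChart_coe_symm (Z : Set E) (e : OpenPartialHomeomorph E (F × K))
    (h : ∀ y ∈ e.source, y ∈ Z ↔ (e y).1 = 0) (z : Z) {k : K}
    (hk : ((0, k) : F × K) ∈ e.target) :
    ((sliceChart Z e h z).symm k : E) = e.symm (0, k) := by
  change ((if hk : ((0, k) : F × K) ∈ e.target then
        (⟨e.symm (0, k), (h _ (e.map_target hk)).2 (by rw [e.right_inv hk])⟩ : Z) else z : Z) : E)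
      = _
  rw [dif_pos hk]

end

variable {E F : Type*} [NormedAddCommGroup E] [NormedSpace ℝ E] [NormedAddCommGroup F]
  [NormedSpace ℝ F] [FiniteDimensional ℝ E] [CompleteSpace F]

/-- Around a zero where the derivative of the analytic map `g` is onto, there is an analytic
coordinate system of the ambient space whose first component is `g`. -/
theorem exists_flattening (g : E → F) (hg : ContDiff ℝ ω g) (d : ℕ) (x : E)
    (hsurj : (fderiv ℝ g x).range = ⊤)
    (hd : Module.finrank ℝ E - Module.finrank ℝ F = d) :
    ∃ e : OpenPartialHomeomorph E (F × EuclideanSpace ℝ (Fin d)),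
      x ∈ e.source ∧ (∀ y ∈ e.source, (e y).1 = g y) ∧
      ContDiffOn ℝ ω e e.source ∧ ContDiffOn ℝ ω e.symm e.target := by
  have : CompleteSpace E := FiniteDimensional.complete ℝ E
  have hs : HasStrictFDerivAt g (fderiv ℝ g x) x := hg.contDiffAt.hasStrictFDerivAt (by simp)
  have hker : Module.finrank ℝ (fderiv ℝ g x).ker = Module.finrank ℝ (EuclideanSpace ℝ (Fin d)) := by
    have h1 := LinearMap.finrank_range_add_finrank_ker (fderiv ℝ g x : E →ₗ[ℝ] F)
    have h2 : Module.finrank ℝ (LinearMap.range (fderiv ℝ g x : E →ₗ[ℝ] F)) = Module.finrank ℝ F := by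
      have : LinearMap.range (fderiv ℝ g x : E →ₗ[ℝ] F) = ⊤ := hsurj
      rw [this, finrank_top]
    have h3 : Module.finrank ℝ (fderiv ℝ g x).ker
        = Module.finrank ℝ (LinearMap.ker (fderiv ℝ g x : E →ₗ[ℝ] F)) := rfl
    rw [finrank_euclideanSpace, Fintype.card_fin]
    omega
  let L : (fderiv ℝ g x).ker ≃L[ℝ] EuclideanSpace ℝ (Fin d) := ContinuousLinearEquiv.ofFinrankEq hker
  obtain ⟨p, hp⟩ : (fderiv ℝ g x).ker.ClosedComplemented :=
    Submodule.ClosedComplemented.of_finiteDimensional_quotient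
      (Submodule.closed_of_finiteDimensional _)
  let φ : ImplicitFunctionData ℝ E F (EuclideanSpace ℝ (Fin d)) :=
    { leftFun := g
      leftDeriv := fderiv ℝ g x
      rightFun := (L : (fderiv ℝ g x).ker →L[ℝ] EuclideanSpace ℝ (Fin d)).comp p
      rightDeriv := (L : (fderiv ℝ g x).ker →L[ℝ] EuclideanSpace ℝ (Fin d)).comp p
      pt := x
      hasStrictFDerivAt_leftFun := hs
      hasStrictFDerivAt_rightFun :=
        ((L : (fderiv ℝ g x).ker →L[ℝ] EuclideanSpace ℝ (Fin d)).comp p).hasStrictFDerivAt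
      range_leftDeriv := hsurj
      range_rightDeriv := by
        rw [LinearMap.range_eq_top]
        intro k
        exact ⟨(L.symm k : E), by simp [hp]⟩
      isCompl_ker := by
        have h1 : ((L : (fderiv ℝ g x).ker →L[ℝ] EuclideanSpace ℝ (Fin d)).comp p).ker = p.ker := by
          ext y; simp
        rw [h1]
        exact LinearMap.isCompl_of_proj hp }
  have hφ : ContDiff ℝ ω φ.prodFun :=
    hg.prodMk ((L : (fderiv ℝ g x).ker →L[ℝ] EuclideanSpace ℝ (Fin d)).comp p).contDiff
  have hω : (ω : ℕ∞ω) ≠ ∞ := by decide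
  refine ⟨φ.toOpenPartialHomeomorph.restrContDiff ℝ ω hω, ?_, fun y _ => rfl, ?_, ?_⟩
  · refine ⟨φ.pt_mem_toOpenPartialHomeomorph_source, hφ.contDiffAt, ?_⟩
    have h := φ.pt_mem_toOpenPartialHomeomorph_source
    have hinv : φ.toOpenPartialHomeomorph.symm (φ.toOpenPartialHomeomorph x) = x :=
      φ.toOpenPartialHomeomorph.left_inv h
    apply φ.toOpenPartialHomeomorph.contDiffAt_symm (φ.toOpenPartialHomeomorph.map_source h)
    · rw [hinv]
      exact φ.hasStrictFDerivAt.hasFDerivAt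
    · exact hφ.contDiffAt
  · exact φ.toOpenPartialHomeomorph.contDiffOn_restrContDiff_source ℝ hω
  · exact φ.toOpenPartialHomeomorph.contDiffOn_restrContDiff_target ℝ hω

/-- The chosen analytic coordinate system around a regular zero. -/
def flattening (g : E → F) (hg : ContDiff ℝ ω g) (d : ℕ)
    (hd : Module.finrank ℝ E - Module.finrank ℝ F = d) (x : E)
    (hsurj : (fderiv ℝ g x).range = ⊤) :
    OpenPartialHomeomorph E (F × EuclideanSpace ℝ (Fin d)) :=
  (exists_flattening g hg d x hsurj hd).choose

/-- The chart of the zero set `Z` of `g` around `z`: all but the first component of the chosen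
analytic coordinate system, whose first component is `g`. -/
def chart (g : E → F) (hg : ContDiff ℝ ω g) (d : ℕ)
    (hd : Module.finrank ℝ E - Module.finrank ℝ F = d) (Z : Set E) (hZ : ∀ x, x ∈ Z ↔ g x = 0)
    (hsurj : ∀ x ∈ Z, (fderiv ℝ g x).range = ⊤) (z : Z) :
    OpenPartialHomeomorph Z (EuclideanSpace ℝ (Fin d)) :=
  sliceChart Z (flattening g hg d hd z (hsurj z z.2))
    (fun y hy => by
      rw [hZ, ← (exists_flattening g hg d z (hsurj z z.2) hd).choose_spec.2.1 y hy]
      rfl) z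

/-- A regular zero set is a manifold, with the charts `chart`. -/
@[reducible]
def chartedSpace (g : E → F) (hg : ContDiff ℝ ω g) (d : ℕ)
    (hd : Module.finrank ℝ E - Module.finrank ℝ F = d) (Z : Set E) (hZ : ∀ x, x ∈ Z ↔ g x = 0)
    (hsurj : ∀ x ∈ Z, (fderiv ℝ g x).range = ⊤) :
    ChartedSpace (EuclideanSpace ℝ (Fin d)) Z where
  atlas := Set.range (chart g hg d hd Z hZ hsurj)
  chartAt := chart g hg d hd Z hZ hsurj
  mem_chart_source z := (exists_flattening g hg d z (hsurj z z.2) hd).choose_spec.1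
  chart_mem_atlas z := ⟨z, rfl⟩

theorem isManifold (g : E → F) (hg : ContDiff ℝ ω g) (d : ℕ)
    (hd : Module.finrank ℝ E - Module.finrank ℝ F = d) (Z : Set E) (hZ : ∀ x, x ∈ Z ↔ g x = 0)
    (hsurj : ∀ x ∈ Z, (fderiv ℝ g x).range = ⊤) :
    letI := chartedSpace g hg d hd Z hZ hsurj
    IsManifold (𝓡 d) ω Z := by
  let := chartedSpace g hg d hd Z hZ hsurj
  apply isManifold_of_contDiffOn
  rintro _ _ ⟨z, rfl⟩ ⟨z', rfl⟩
  have h1 := (exists_flattening g hg d z (hsurj z z.2) hd).choose_spec.2.2.2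
  have h2 := (exists_flattening g hg d z' (hsurj z' z'.2) hd).choose_spec.2.2.1
  have hsub : ∀ k ∈ ((chart g hg d hd Z hZ hsurj z).symm ≫ₕ chart g hg d hd Z hZ hsurj z').source,
      ((0, k) : F × _) ∈ (flattening g hg d hd z (hsurj z z.2)).target ∧
      (flattening g hg d hd z (hsurj z z.2)).symm (0, k) ∈
        (flattening g hg d hd z' (hsurj z' z'.2)).source := by
    intro k hk
    rw [OpenPartialHomeomorph.trans_source] at hk
    have hk1 : ((0, k) : F × _) ∈ (flattening g hg d hd z (hsurj z z.2)).target := hk.1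
    refine ⟨hk1, ?_⟩
    rw [← sliceChart_coe_symm Z _ _ z hk1]
    exact hk.2
  simp only [modelWithCornersSelf_coe, modelWithCornersSelf_coe_symm, Set.range_id, Set.inter_univ,
    Set.preimage_id_eq, id_eq, Function.comp_id, Function.id_comp]
  refine ContDiffOn.congr (f := fun k => (flattening g hg d hd z' (hsurj z' z'.2)
    ((flattening g hg d hd z (hsurj z z.2)).symm (0, k))).2) ?_ ?_
  · refine contDiff_snd.comp_contDiffOn (h2.comp (h1.comp ?_ fun k hk => (hsub k hk).1)
      fun k hk => (hsub k hk).2)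
    exact (contDiff_const.prodMk contDiff_id).contDiffOn
  · intro k hk
    have := sliceChart_coe_symm Z _ (fun y hy => by
      rw [hZ, ← (exists_flattening g hg d z (hsurj z z.2) hd).choose_spec.2.1 y hy]
      rfl) z (hsub k hk).1
    rw [← this]
    rfl

end RegularZeroSet

/-! ### Clifford systems and their focal submanifolds -/

/-- A symmetric Clifford system `P_0, …, P_m` on `ℝ^{2l}`. -/
structure CliffordSystem (m l : ℕ) where
  P : Fin (m + 1) → Matrix (Fin (2 * l)) (Fin (2 * l)) ℝ
  symm : ∀ i, (P i).IsSymm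
  clifford : ∀ i j, P i * P j + P j * P i = if i = j then 2 else 0

namespace CliffordSystem

variable {m l : ℕ} (C : CliffordSystem m l)

/-- `P_i` as an operator on the Euclidean space `ℝ^{2l}`. -/
def op (i : Fin (m + 1)) : EuclideanSpace ℝ (Fin (2 * l)) →L[ℝ] EuclideanSpace ℝ (Fin (2 * l)) :=
  Matrix.toEuclideanCLM (𝕜 := ℝ) (C.P i)

/-- The polynomial `F(x) = |x|⁴ - 2 ∑ ⟨P_i x, x⟩²`. -/
def F (x : EuclideanSpace ℝ (Fin (2 * l))) : ℝ :=
  ‖x‖ ^ 4 - 2 * ∑ i, (inner ℝ (C.op i x) x) ^ 2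

/-- The focal submanifold `M_+`: the level set `f = 1` of the restriction `f` of `F` to the unit
sphere. -/
def focal : Set (EuclideanSpace ℝ (Fin (2 * l))) :=
  {x | ‖x‖ = 1 ∧ C.F x = 1}

/-- The functions `|x|² - 1` and `⟨P_i x, x⟩`, which cut out `M_+` transversally. -/
def defining (x : EuclideanSpace ℝ (Fin (2 * l))) : ℝ × (Fin (m + 1) → ℝ) :=
  (inner ℝ x x - 1, fun i => inner ℝ (C.op i x) x)

theorem contDiff_defining : ContDiff ℝ ω C.defining := by
  refine ((contDiff_id.inner ℝ contDiff_id).sub contDiff_const).prodMk ?_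
  exact contDiff_pi.2 fun i => (C.op i).contDiff.inner ℝ contDiff_id

theorem mem_focal_iff (x : EuclideanSpace ℝ (Fin (2 * l))) :
    x ∈ C.focal ↔ C.defining x = 0 := by
  have hs : 0 ≤ ∑ i, (inner ℝ (C.op i x) x) ^ 2 := Finset.sum_nonneg fun i _ => sq_nonneg _
  simp only [focal, F, defining, Set.mem_ofPred_eq, Prod.mk_eq_zero, real_inner_self_eq_norm_sq,
    funext_iff, Pi.zero_apply]
  constructor
  · rintro ⟨h1, h2⟩
    rw [h1] at h2
    have h3 : ∑ i, (inner ℝ (C.op i x) x) ^ 2 = 0 := by linarith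
    rw [Finset.sum_eq_zero_iff_of_nonneg fun i _ => sq_nonneg _] at h3
    exact ⟨by rw [h1]; norm_num, fun i => pow_eq_zero_iff two_ne_zero |>.1 (h3 i (Finset.mem_univ i))⟩
  · rintro ⟨h1, h2⟩
    have h3 : ‖x‖ = 1 := by nlinarith [norm_nonneg x]
    refine ⟨h3, ?_⟩
    simp [h2, h3]

theorem op_symm (i : Fin (m + 1)) (x y : EuclideanSpace ℝ (Fin (2 * l))) :
    inner ℝ (C.op i x) y = inner ℝ x (C.op i y) := by
  have h : (C.op i).adjoint = C.op i := by
    rw [← ContinuousLinearMap.star_eq_adjoint, op, ← map_star, Matrix.star_eq_conjTranspose,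
      Matrix.conjTranspose_eq_transpose_of_trivial, C.symm i]
  conv_rhs => rw [← h]
  rw [ContinuousLinearMap.adjoint_inner_right]

theorem op_op (i j : Fin (m + 1)) (x : EuclideanSpace ℝ (Fin (2 * l))) :
    C.op i (C.op j x) + C.op j (C.op i x) = if i = j then (2 : ℝ) • x else 0 := by
  have h : C.op i * C.op j + C.op j * C.op i = if i = j then 2 else 0 := by
    rw [op, op, ← map_mul, ← map_mul, ← map_add, C.clifford]
    split_ifs
    · exact map_ofNat _ 2
    · exact map_zero _
  have h2 := congrArg (fun T => T x) h
  refine Eq.trans h2 ?_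
  split_ifs
  · rw [two_smul]
    have h3 : (2 : EuclideanSpace ℝ (Fin (2 * l)) →L[ℝ] EuclideanSpace ℝ (Fin (2 * l))) = 1 + 1 :=
      one_add_one_eq_two.symm
    rw [h3]
    rfl
  · rfl

theorem inner_op_op (i j : Fin (m + 1)) (x : EuclideanSpace ℝ (Fin (2 * l))) :
    inner ℝ (C.op i x) (C.op j x) = if i = j then inner ℝ x x else 0 := by
  have h := congrArg (fun y => inner ℝ y x) (C.op_op i j x)
  simp only [inner_add_left] at h
  rw [C.op_symm i (C.op j x), C.op_symm j (C.op i x), real_inner_comm (C.op i x)] at h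
  split_ifs at h ⊢ with hij
  · rw [real_inner_smul_left] at h; linarith
  · rw [inner_zero_left] at h; linarith

theorem fderiv_defining_apply (x y : EuclideanSpace ℝ (Fin (2 * l))) :
    fderiv ℝ C.defining x y = (2 * inner ℝ x y, fun i => 2 * inner ℝ (C.op i x) y) := by
  have h1 : HasFDerivAt (fun x : EuclideanSpace ℝ (Fin (2 * l)) => inner ℝ x x - (1 : ℝ)) _ x :=
    ((hasFDerivAt_id (𝕜 := ℝ) x).inner ℝ (hasFDerivAt_id x)).sub_const 1
  have h2 : HasFDerivAt (fun x : EuclideanSpace ℝ (Fin (2 * l)) =>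
      fun i => (inner ℝ (C.op i x) x : ℝ)) _ x :=
    hasFDerivAt_pi.2 fun i => (C.op i).hasFDerivAt.inner ℝ (hasFDerivAt_id (𝕜 := ℝ) x)
  have h3 : HasFDerivAt C.defining _ x := h1.prodMk h2
  rw [h3.fderiv]
  refine Prod.ext ?_ (funext fun i => ?_)
  · simp [fderivInnerCLM_apply, real_inner_comm, two_mul]
  · have h4 : inner ℝ (C.op i y) x = inner ℝ (C.op i x) y := by
      rw [C.op_symm, real_inner_comm]
    simp [fderivInnerCLM_apply, h4, two_mul]

theorem range_fderiv_defining (x : EuclideanSpace ℝ (Fin (2 * l))) (hx : x ∈ C.focal) :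
    (fderiv ℝ C.defining x).range = ⊤ := by
  rw [LinearMap.range_eq_top]
  rintro ⟨a, b⟩
  have h1 : inner ℝ x x = (1 : ℝ) := by rw [real_inner_self_eq_norm_sq, hx.1]; norm_num
  have h2 : ∀ i, inner ℝ (C.op i x) x = (0 : ℝ) := fun i =>
    congrFun (congrArg Prod.snd ((C.mem_focal_iff x).1 hx)) i
  have h3 : ∀ i, inner ℝ x (C.op i x) = (0 : ℝ) := fun i => by rw [real_inner_comm, h2]
  refine ⟨(a / 2) • x + ∑ i, (b i / 2) • C.op i x, ?_⟩
  refine (C.fderiv_defining_apply x _).trans (Prod.ext ?_ (funext fun i => ?_))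
  · simp [inner_add_right, inner_sum, real_inner_smul_right, hx.1, h3]
    ring
  · simp [inner_add_right, inner_sum, real_inner_smul_right, hx.1, h2, C.inner_op_op]
    ring

/-- `M_+` is a smooth manifold, as a regular zero set in `ℝ^{2l}`. -/
instance : ChartedSpace (EuclideanSpace ℝ (Fin (2 * l - (m + 2)))) C.focal :=
  RegularZeroSet.chartedSpace C.defining C.contDiff_defining _
    (by simp; omega) C.focal C.mem_focal_iff C.range_fderiv_defining

instance : IsManifold (𝓡 (2 * l - (m + 2))) ω C.focal :=
  RegularZeroSet.isManifold C.defining C.contDiff_defining _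
    (by simp; omega) C.focal C.mem_focal_iff C.range_fderiv_defining

/-! ### The product `S¹ × M_+` -/

/-- The manifold `N = S¹ × M_+`. -/
abbrev N : Type := Circle × C.focal

/-- The model vector space of `S¹ × M_+`. -/
abbrev ModelN (_C : CliffordSystem m l) : Type :=
  EuclideanSpace ℝ (Fin 1) × EuclideanSpace ℝ (Fin (2 * l - (m + 2)))

/-- The model with corners of the product manifold `S¹ × M_+`. -/
abbrev modelN : ModelWithCorners ℝ C.ModelN
    (ModelProd (EuclideanSpace ℝ (Fin 1)) (EuclideanSpace ℝ (Fin (2 * l - (m + 2))))) :=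
  (𝓡 1).prod (𝓡 (2 * l - (m + 2)))

/-- The inclusion of `S¹ × M_+` into `ℂ × ℝ^{2l}`. -/
def incl (p : C.N) : ℂ × EuclideanSpace ℝ (Fin (2 * l)) := (p.1, p.2)

/-- The differential of the inclusion. It identifies a tangent vector of `S¹ × M_+` at `(a, x)`
with a pair `(s, X)`, where `s ∈ T_a S¹ ⊆ ℂ` and `X ∈ T_x M_+ ⊆ ℝ^{2l}`. -/
def dincl (p : C.N) : TangentSpace C.modelN p →L[ℝ] ℂ × EuclideanSpace ℝ (Fin (2 * l)) :=
  mfderiv C.modelN 𝓘(ℝ, ℂ × EuclideanSpace ℝ (Fin (2 * l))) C.incl p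

/-- The product metric on `S¹ × M_+`, each factor carrying the metric induced from its ambient
Euclidean space. -/
def productMetric (p : C.N) (u v : TangentSpace C.modelN p) : ℝ :=
  inner ℝ (C.dincl p u).1 (C.dincl p v).1 + inner ℝ (C.dincl p u).2 (C.dincl p v).2

end CliffordSystem

/-! ### Almost complex, complex and Hermitian structures -/

section Structures

variable {E : Type*} [NormedAddCommGroup E] [NormedSpace ℝ E] {H : Type*} [TopologicalSpace H]
  (I : ModelWithCorners ℝ E H) {M : Type*} [TopologicalSpace M] [ChartedSpace H M]

/-- `J` is a smooth field of endomorphisms of the tangent bundle with `J² = -1`. -/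
structure IsAlmostComplex [IsManifold I 1 M]
    (J : ∀ p : M, TangentSpace I p →L[ℝ] TangentSpace I p) : Prop where
  smooth : ContMDiff I (I.prod 𝓘(ℝ, E →L[ℝ] E)) ∞ fun p : M =>
    (Bundle.TotalSpace.mk' (E →L[ℝ] E) p (J p) :
      Bundle.TotalSpace (E →L[ℝ] E) fun p : M => TangentSpace I p →L[ℝ] TangentSpace I p)
  sq : ∀ (p : M) (v : TangentSpace I p), J p (J p v) = -v

variable {I} in
/-- The differential at `p` of a chart with values in `ℂ^n`, as a real linear map into `ℂ^n`. -/
def chartDifferential {n : ℕ} (φ : OpenPartialHomeomorph M (EuclideanSpace ℂ (Fin n))) (p : M) :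
    TangentSpace I p →L[ℝ] EuclideanSpace ℂ (Fin n) :=
  mfderiv I 𝓘(ℝ, EuclideanSpace ℂ (Fin n)) φ p

/-- `J` is integrable: the manifold carries a complex manifold structure of complex dimension `n`
whose charts are smooth coordinates of the given smooth manifold and whose multiplication by the
imaginary unit on tangent spaces is `J`. -/
def IsIntegrable (n : ℕ) (J : ∀ p : M, TangentSpace I p →L[ℝ] TangentSpace I p) : Prop :=
  ∃ cs : ChartedSpace (EuclideanSpace ℂ (Fin n)) M,
    IsManifold 𝓘(ℂ, EuclideanSpace ℂ (Fin n)) ω M ∧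
    ∀ φ ∈ cs.atlas,
      ContMDiffOn I 𝓘(ℝ, EuclideanSpace ℂ (Fin n)) ∞ φ φ.source ∧
      ContMDiffOn 𝓘(ℝ, EuclideanSpace ℂ (Fin n)) I ∞ φ.symm φ.target ∧
      ∀ p ∈ φ.source, ∀ v : TangentSpace I p,
        chartDifferential φ p (J p v) = Complex.I • chartDifferential φ p v

/-- `(M, J, g)` is a Hermitian manifold of complex dimension `n`: `J` is an integrable almost
complex structure and `g` is a smooth Riemannian metric that is invariant under `J`. -/
structure IsHermitian (n : ℕ) [IsManifold I 1 M]
    (J : ∀ p : M, TangentSpace I p →L[ℝ] TangentSpace I p)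
    (g : ∀ p : M, TangentSpace I p → TangentSpace I p → ℝ) : Prop where
  almostComplex : IsAlmostComplex I J
  integrable : IsIntegrable I n J
  metric : ∃ G : Bundle.ContMDiffRiemannianMetric I ∞ E (fun p : M => TangentSpace I p),
    ∀ (p : M) (u v : TangentSpace I p), G.inner p u v = g p u v
  invariant : ∀ (p : M) (u v : TangentSpace I p), g p (J p u) (J p v) = g p u v

end Structures

namespace CliffordSystem

variable {l : ℕ} (C : CliffordSystem 1 l)

/-- The vector `η(x) = P_0 P_1 x`. -/
def eta (x : EuclideanSpace ℝ (Fin (2 * l))) : EuclideanSpace ℝ (Fin (2 * l)) :=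
  C.op 0 (C.op 1 x)

/-- The defining relations of `J` at every `(a, x)`, tangent vectors being written as pairs in
`ℂ × ℝ^{2l}`: with `ε = √-1 a`, one has `J ε = η` and `J η = -ε`, and `J X = P_0 P_1 X` for `X` in
the orthogonal complement `V` of `η` in `T_x M_+`. -/
structure IsCliffordJ (J : ∀ p : C.N, TangentSpace C.modelN p →L[ℝ] TangentSpace C.modelN p) :
    Prop where
  map_epsilon : ∀ (p : C.N) (v : TangentSpace C.modelN p),
    C.dincl p v = (Complex.I * p.1, 0) → C.dincl p (J p v) = (0, C.eta p.2)
  map_eta : ∀ (p : C.N) (v : TangentSpace C.modelN p),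
    C.dincl p v = (0, C.eta p.2) → C.dincl p (J p v) = (-(Complex.I * p.1), 0)
  map_V : ∀ (p : C.N) (v : TangentSpace C.modelN p) (X : EuclideanSpace ℝ (Fin (2 * l))),
    C.dincl p v = (0, X) → inner ℝ X (C.eta p.2) = 0 →
      C.dincl p (J p v) = (0, C.op 0 (C.op 1 X))

end CliffordSystem

end

/-! The operator `T = P_0 P_1` is an orthogonal complex structure on `ℝ^{2l}`, and the Clifford
relations make `b(x, y) = ⟨P_0 x, y⟩ - √-1 ⟨P_1 x, y⟩` complex bilinear for it (`bilin`). Both real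
equations `⟨P_i x, x⟩ = 0` therefore combine into the single holomorphic equation `b(w, w) = 0`, and
`M_+` is the unit link of a complex quadric cone that is smooth away from its vertex
(`mem_focal_iff_cone`, `exists_cone_flattening`).

Integrability comes from the multivalued map `(e^{√-1 θ}, x) ↦ e^θ x` into the punctured cone. Its
differential sends `ε` to `e^θ x`, `η` to `e^θ T x = √-1 e^θ x`, and `X` in `V` to `e^θ X`; so it
carries `J` to multiplication by `√-1` (`fderiv_lift_ambientJ`). Each branch of the angle gives a
local diffeomorphism onto an open piece of the cone (`toCone`), and two branches differ locally by a
positive constant factor (`eventually_lift_eq_smul`). Holomorphic charts of the cone thus pull back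
to charts of `S¹ × M_+` with holomorphic transitions. In effect `S¹ × M_+` is the punctured cone
modulo `w ↦ e^{2π} w`, as for a Hopf manifold.

The remaining claims are handled in the ambient space `ℂ × ℝ^{2l}`. The defining relations say
exactly that the inclusion intertwines `J` with an explicit polynomial field `ambientJ`
(`isCliffordJ_iff`). This yields existence and uniqueness, `J² = -1` and invariance of the metric by
linear algebra, and smoothness of `J` because the inclusion is an immersion. -/

noncomputable section

/-! ### Tensor fields induced by an immersion into a vector space -/

namespace Immersion

open Bundle ContinuousLinearMap

variable {E : Type*} [NormedAddCommGroup E] [NormedSpace ℝ E] {H : Type*} [TopologicalSpace H]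
  {I : ModelWithCorners ℝ E H} {M : Type*} [TopologicalSpace M] [ChartedSpace H M]
  {A : Type*} [NormedAddCommGroup A] [NormedSpace ℝ A]

variable (I) in
/-- The differential of a map into a normed space, with values in that space. -/
def differential (ι : M → A) (p : M) : TangentSpace I p →L[ℝ] A :=
  mfderiv I 𝓘(ℝ, A) ι p

/-- The pull-back of a continuous bilinear form by the differential of a map. -/
def pullback (ι : M → A) (b : A →L[ℝ] A →L[ℝ] ℝ) (p : M) :
    TangentSpace I p →L[ℝ] TangentSpace I p →L[ℝ] ℝ :=
  b.bilinearComp (E' := E) (F' := E) (differential I ι p) (differential I ι p)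

theorem pullback_apply (ι : M → A) (b : A →L[ℝ] A →L[ℝ] ℝ) (p : M) (u v : TangentSpace I p) :
    pullback ι b p u v = b (differential I ι p u) (differential I ι p v) :=
  rfl

variable [IsManifold I 1 M]

/-- The differential of a smooth map into a normed space, read in the trivialization of the tangent
bundle around a point, is smooth. -/
theorem contMDiffAt_differential_comp_symmL {ι : M → A} (hι : ContMDiff I 𝓘(ℝ, A) ∞ ι) (p₀ : M) :
    ContMDiffAt I 𝓘(ℝ, E →L[ℝ] A) ∞ (fun p => (differential I ι p).comp
      ((trivializationAt E (TangentSpace I) p₀).symmL ℝ p)) p₀ := by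
  -- This is smoothness in tangent coordinates on both sides; on the target those coordinates are
  -- trivial, because `A` is a vector space.
  have h := (hι p₀).mfderiv_const (m := ∞) (by simp)
  refine h.congr_of_eventuallyEq (Filter.Eventually.of_forall fun p => ?_)
  ext v
  simp only [inTangentCoordinates, inCoordinates, differential]
  simp [TangentBundle.continuousLinearMapAt_model_space]
  rfl

/-- A field of endomorphisms of the tangent bundle is smooth if an immersion into a normed space
intertwines it with a smooth field of endomorphisms of that space. -/
theorem contMDiff_section_of_intertwines [FiniteDimensional ℝ E] [FiniteDimensional ℝ A] {ι : M → A}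
    (hι : ContMDiff I 𝓘(ℝ, A) ∞ ι) (hinj : ∀ p, Function.Injective (differential I ι p))
    {S : M → A →L[ℝ] A} (hS : ContMDiff I 𝓘(ℝ, A →L[ℝ] A) ∞ S)
    {J : ∀ p : M, TangentSpace I p →L[ℝ] TangentSpace I p}
    (hJ : ∀ p v, differential I ι p (J p v) = S p (differential I ι p v)) :
    ContMDiff I (I.prod 𝓘(ℝ, E →L[ℝ] E)) ∞ fun p : M =>
    (Bundle.TotalSpace.mk' (E →L[ℝ] E) p (J p) :
      Bundle.TotalSpace (E →L[ℝ] E) fun p : M => TangentSpace I p →L[ℝ] TangentSpace I p) := by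
  intro p₀
  rw [contMDiffAt_hom_bundle]
  refine ⟨contMDiffAt_id, ?_⟩
  set τ := trivializationAt E (TangentSpace I) p₀ with hτ
  have hp₀ : p₀ ∈ τ.baseSet := FiberBundle.mem_baseSet_trivializationAt' p₀
  let D : M → E →L[ℝ] A := fun p => (differential I ι p).comp (τ.symmL ℝ p)
  have hD : ContMDiffAt I 𝓘(ℝ, E →L[ℝ] A) ∞ D p₀ := contMDiffAt_differential_comp_symmL hι p₀
  have hD0 : Function.Injective (D p₀) := by
    intro u v huv
    have := hinj p₀ huv
    have h2 := congrArg (τ.continuousLinearMapAt ℝ p₀) this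
    exact ((τ.continuousLinearMapAt_symmL hp₀ u).symm.trans h2).trans
      (τ.continuousLinearMapAt_symmL hp₀ v)
  -- One fixed left inverse at `p₀` suffices: `L ∘ D p` is the identity at `p₀`, hence invertible
  -- nearby, and `J` reads there as `(L ∘ D)⁻¹ ∘ L ∘ S ∘ D`.
  obtain ⟨L, hL'⟩ := ContinuousLinearMap.HasLeftInverse.of_injective_of_finiteDimensional hD0
  have hL : L.comp (D p₀) = ContinuousLinearMap.id ℝ E := ContinuousLinearMap.ext hL'
  have hLD : ContMDiffAt I 𝓘(ℝ, E →L[ℝ] E) ∞ (fun p => L.comp (D p)) p₀ :=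
    contMDiffAt_const.clm_comp hD
  have hinv : ContMDiffAt I 𝓘(ℝ, E →L[ℝ] E) ∞ (fun p => (L.comp (D p)).inverse) p₀ := by
    have : ContDiffAt ℝ ∞ (ContinuousLinearMap.inverse : (E →L[ℝ] E) → (E →L[ℝ] E))
        (L.comp (D p₀)) := by
      rw [hL]
      have : CompleteSpace E := FiniteDimensional.complete ℝ E
      exact contDiffAt_map_inverse (ContinuousLinearEquiv.refl ℝ E)
    exact this.contMDiffAt.comp p₀ hLD
  have hev : ∀ᶠ p in 𝓝 p₀, (L.comp (D p)).IsInvertible := by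
    have : CompleteSpace E := FiniteDimensional.complete ℝ E
    have h1 : ∀ᶠ T in 𝓝 (L.comp (D p₀)), T.IsInvertible := by
      rw [hL]
      exact (ContinuousLinearEquiv.refl ℝ E).nhds
    exact hLD.continuousAt.eventually h1
  refine (hinv.clm_comp (((contMDiffAt_const (c := L)).clm_comp (hS p₀)).clm_comp hD)
    ).congr_of_eventuallyEq ?_
  filter_upwards [hev, τ.open_baseSet.mem_nhds hp₀] with p hp hpτ
  have key : (L.comp (D p)).comp (inCoordinates E (TangentSpace I) E (TangentSpace I) p₀ p p₀ p
      (J p)) = (L.comp (S p)).comp (D p) := by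
    ext v
    simp only [inCoordinates, ContinuousLinearMap.comp_apply, D, ← hτ]
    rw [τ.symmL_continuousLinearMapAt hpτ, hJ]
  change _ = (L.comp (D p)).inverse.comp ((L.comp (S p)).comp (D p))
  rw [← key, ← ContinuousLinearMap.comp_assoc,
    hp.inverse_comp_self, ContinuousLinearMap.id_comp]

theorem contMDiff_pullback {ι : M → A} (hι : ContMDiff I 𝓘(ℝ, A) ∞ ι) (b : A →L[ℝ] A →L[ℝ] ℝ) :
    ContMDiff I (I.prod 𝓘(ℝ, E →L[ℝ] E →L[ℝ] ℝ)) ∞ fun p : M =>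
    (Bundle.TotalSpace.mk' (E →L[ℝ] E →L[ℝ] ℝ) p (pullback ι b p) :
      Bundle.TotalSpace (E →L[ℝ] E →L[ℝ] ℝ)
        fun p : M => TangentSpace I p →L[ℝ] TangentSpace I p →L[ℝ] ℝ) := by
  intro p₀
  rw [contMDiffAt_hom_bundle]
  refine ⟨contMDiffAt_id, ?_⟩
  set τ := trivializationAt E (TangentSpace I) p₀ with hτ
  have hp₀ : p₀ ∈ τ.baseSet := FiberBundle.mem_baseSet_trivializationAt' p₀
  let D : M → E →L[ℝ] A := fun p => (differential I ι p).comp (τ.symmL ℝ p)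
  have hD : ContMDiffAt I 𝓘(ℝ, E →L[ℝ] A) ∞ D p₀ := contMDiffAt_differential_comp_symmL hι p₀
  have h : ContMDiffAt I 𝓘(ℝ, E →L[ℝ] E →L[ℝ] ℝ) ∞ (fun p => b.bilinearComp (D p) (D p)) p₀ := by
    have h1 : ContMDiffAt I 𝓘(ℝ, E →L[ℝ] A →L[ℝ] ℝ) ∞ (fun p => b.comp (D p)) p₀ :=
      contMDiffAt_const.clm_comp hD
    have h2 : ContMDiffAt I 𝓘(ℝ, (A →L[ℝ] ℝ) →L[ℝ] E →L[ℝ] ℝ) ∞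
        (fun p => (D p).precomp ℝ) p₀ := hD.clm_precomp
    exact h2.clm_comp h1
  refine h.congr_of_eventuallyEq ?_
  filter_upwards [τ.open_baseSet.mem_nhds hp₀] with p hp
  ext u v
  rw [inCoordinates_apply_eq₂ hp hp (by simp)]
  simp [pullback_apply, D, ← hτ, τ.symmL_apply hp]

/-- A symmetric positive definite form on the target of an immersion induces a Riemannian metric. -/
def riemannianMetric [FiniteDimensional ℝ A] {ι : M → A}
    (hι : ContMDiff I 𝓘(ℝ, A) ∞ ι) (hinj : ∀ p, Function.Injective (differential I ι p))
    (b : A →L[ℝ] A →L[ℝ] ℝ) (hsymm : ∀ u v, b u v = b v u) (c : ℝ) (hc : 0 < c)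
    (hb : ∀ u, c * ‖u‖ ^ 2 ≤ b u u) :
    ContMDiffRiemannianMetric I ∞ E (fun p : M => TangentSpace I p) where
  inner := pullback ι b
  symm p u v := hsymm (differential I ι p u) (differential I ι p v)
  pos p v hv := by
    have h : differential I ι p v ≠ 0 := fun h => hv (hinj p (h.trans (map_zero _).symm))
    exact lt_of_lt_of_le (by positivity) (hb (differential I ι p v))
  isVonNBounded p := by
    obtain ⟨L, hL⟩ := ContinuousLinearMap.HasLeftInverse.of_injective_of_finiteDimensional
      (f := (differential I ι p : E →L[ℝ] A)) (hinj p)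
    -- The radius `1 / c + 1` avoids a square root: `t² < 1 / c` bounds `t` through `2 t ≤ t² + 1`.
    -- The unit ball of the form lies in the image of this ball under the left inverse `L`.
    have h1 : Bornology.IsVonNBounded ℝ (Metric.ball (0 : A) (1 / c + 1)) :=
      NormedSpace.isVonNBounded_ball ℝ A _
    refine (h1.image L).subset ?_
    intro v hv
    refine ⟨differential I ι p v, ?_, hL v⟩
    have h2 := hb (differential I ι p v)
    have h3 : b (differential I ι p v) (differential I ι p v) < 1 := hv
    have h4 : ‖differential I ι p v‖ ^ 2 < 1 / c := by
      rw [lt_div_iff₀ hc]; linarith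
    rw [mem_ball_zero_iff]
    nlinarith [sq_nonneg (‖differential I ι p v‖ - 1)]
  contMDiff := contMDiff_pullback hι b

end Immersion

/-! ### Inclusion and tangent spaces of a regular zero set -/

namespace RegularZeroSet

variable {E F : Type*} [NormedAddCommGroup E] [NormedSpace ℝ E] [NormedAddCommGroup F]
  [NormedSpace ℝ F] [FiniteDimensional ℝ E] [CompleteSpace F]
  {g : E → F} {hg : ContDiff ℝ ω g} {d : ℕ}
  {hd : Module.finrank ℝ E - Module.finrank ℝ F = d} {Z : Set E} {hZ : ∀ x, x ∈ Z ↔ g x = 0}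
  {hsurj : ∀ x ∈ Z, (fderiv ℝ g x).range = ⊤}

theorem flattening_spec (hg : ContDiff ℝ ω g)
    (hd : Module.finrank ℝ E - Module.finrank ℝ F = d) (x : E)
    (hsurj : (fderiv ℝ g x).range = ⊤) :
    x ∈ (flattening g hg d hd x hsurj).source ∧
    (∀ y ∈ (flattening g hg d hd x hsurj).source, (flattening g hg d hd x hsurj y).1 = g y) ∧
    ContDiffOn ℝ ω (flattening g hg d hd x hsurj) (flattening g hg d hd x hsurj).source ∧
    ContDiffOn ℝ ω (flattening g hg d hd x hsurj).symm (flattening g hg d hd x hsurj).target :=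
  (exists_flattening g hg d x hsurj hd).choose_spec

theorem coe_chart_symm (z : Z) {k : EuclideanSpace ℝ (Fin d)}
    (hk : ((0, k) : F × EuclideanSpace ℝ (Fin d)) ∈
      (flattening g hg d hd z (hsurj z z.2)).target) :
    ((chart g hg d hd Z hZ hsurj z).symm k : E) =
      (flattening g hg d hd z (hsurj z z.2)).symm (0, k) :=
  sliceChart_coe_symm Z _ _ z hk

theorem contMDiff_coe :
    letI := chartedSpace g hg d hd Z hZ hsurj
    ContMDiff (𝓡 d) 𝓘(ℝ, E) ω ((↑) : Z → E) := by
  let := chartedSpace g hg d hd Z hZ hsurj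
  have := isManifold g hg d hd Z hZ hsurj
  rw [contMDiff_iff]
  refine ⟨continuous_subtype_val, fun z y => ?_⟩
  obtain ⟨-, -, -, h⟩ := flattening_spec hg hd z (hsurj z z.2)
  have h1 : ContDiffOn ℝ ω (fun k : EuclideanSpace ℝ (Fin d) =>
      (flattening g hg d hd z (hsurj z z.2)).symm (0, k))
      (chart g hg d hd Z hZ hsurj z).target :=
    h.comp (contDiff_const.prodMk contDiff_id).contDiffOn fun k hk => hk
  have h2 : ∀ k ∈ (extChartAt (𝓡 d) z).target, k ∈ (chart g hg d hd Z hZ hsurj z).target :=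
    fun k hk => (extChartAt_target (I := 𝓡 d) z ▸ hk).1
  exact ContDiffOn.congr_mono h1 (fun k hk => coe_chart_symm (hZ := hZ) z (h2 k hk.1))
    fun k hk => h2 k hk.1

/-- Read in its own chart, the inclusion is the inverse flattening restricted to the slice `{0} ×
ℝ^d`. Injectivity and image of the differential thereby become linear algebra about an invertible
map. -/
theorem mfderiv_coe (z : Z) :
    letI := chartedSpace g hg d hd Z hZ hsurj
    (mfderiv (𝓡 d) 𝓘(ℝ, E) ((↑) : Z → E) z : EuclideanSpace ℝ (Fin d) →L[ℝ] E) =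
      (fderiv ℝ (flattening g hg d hd z (hsurj z z.2)).symm
        (flattening g hg d hd z (hsurj z z.2) z)).comp
        (ContinuousLinearMap.inr ℝ F (EuclideanSpace ℝ (Fin d))) := by
  let := chartedSpace g hg d hd Z hZ hsurj
  obtain ⟨h0, h1, h2, h3⟩ := flattening_spec hg hd z (hsurj z z.2)
  set e := flattening g hg d hd z (hsurj z z.2) with he
  have hez : e z = (0, (e z).2) := Prod.ext ((h1 z h0).trans ((hZ z).1 z.2)) rfl
  have ht : e z ∈ e.target := e.map_source h0
  have hm : MDifferentiableAt (𝓡 d) 𝓘(ℝ, E) ((↑) : Z → E) z :=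
    (contMDiff_coe (hg := hg) (hd := hd) (hZ := hZ) (hsurj := hsurj) z).mdifferentiableAt (by simp)
  have h4 : HasFDerivAt e.symm (fderiv ℝ e.symm (e z)) (e z) :=
    ((h3.contDiffAt (e.open_target.mem_nhds ht)).differentiableAt (by simp)).hasFDerivAt
  have h5 : HasFDerivAt (fun k : EuclideanSpace ℝ (Fin d) => ((0, k) : F × EuclideanSpace ℝ (Fin d)))
      (ContinuousLinearMap.inr ℝ F (EuclideanSpace ℝ (Fin d))) (e z).2 :=
    (ContinuousLinearMap.inr ℝ F (EuclideanSpace ℝ (Fin d))).hasFDerivAt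
  rw [hez] at h4
  have h6 := h4.comp (e z).2 h5
  rw [← hez] at h6
  have h7 : HasFDerivAt (fun k => ((chart g hg d hd Z hZ hsurj z).symm k : E))
      ((fderiv ℝ e.symm (e z)).comp (ContinuousLinearMap.inr ℝ F (EuclideanSpace ℝ (Fin d))))
      (e z).2 := by
    refine h6.congr_of_eventuallyEq ?_
    have : (e z).2 ∈ (chart g hg d hd Z hZ hsurj z).target :=
      (chart g hg d hd Z hZ hsurj z).map_source h0
    filter_upwards [(chart g hg d hd Z hZ hsurj z).open_target.mem_nhds this] with k hk
    exact coe_chart_symm z hk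
  rw [hm.mfderiv]
  simp only [writtenInExtChartAt, modelWithCornersSelf_coe, Set.range_id, fderivWithin_univ]
  exact h7.fderiv

theorem fderiv_flattening (z : Z) :
    (fderiv ℝ (flattening g hg d hd z (hsurj z z.2)).symm
      (flattening g hg d hd z (hsurj z z.2) z)).comp
        (fderiv ℝ (flattening g hg d hd z (hsurj z z.2)) z) = ContinuousLinearMap.id ℝ E ∧
    (fderiv ℝ (flattening g hg d hd z (hsurj z z.2)) z).comp
      (fderiv ℝ (flattening g hg d hd z (hsurj z z.2)).symm
        (flattening g hg d hd z (hsurj z z.2) z)) = ContinuousLinearMap.id ℝ _ ∧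
    (ContinuousLinearMap.fst ℝ F (EuclideanSpace ℝ (Fin d))).comp
      (fderiv ℝ (flattening g hg d hd z (hsurj z z.2)) z) = fderiv ℝ g z := by
  obtain ⟨h0, h1, h2, h3⟩ := flattening_spec hg hd z (hsurj z z.2)
  set e := flattening g hg d hd z (hsurj z z.2) with he
  have ht : e z ∈ e.target := e.map_source h0
  have h4 : HasFDerivAt e.symm (fderiv ℝ e.symm (e z)) (e z) :=
    ((h3.contDiffAt (e.open_target.mem_nhds ht)).differentiableAt (by simp)).hasFDerivAt
  have h5 : HasFDerivAt e (fderiv ℝ e z) z :=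
    ((h2.contDiffAt (e.open_source.mem_nhds h0)).differentiableAt (by simp)).hasFDerivAt
  refine ⟨?_, ?_, ?_⟩
  · refine (h4.comp (z : E) h5).unique ((hasFDerivAt_id _).congr_of_eventuallyEq ?_)
    exact e.eventually_left_inverse h0
  · rw [← e.left_inv h0] at h5
    have h6 := h5.comp (e z) h4
    rw [e.left_inv h0] at h6
    refine h6.unique ((hasFDerivAt_id _).congr_of_eventuallyEq ?_)
    exact e.eventually_right_inverse ht
  · have h6 : HasFDerivAt (fun y => (e y).1) _ (z : E) := h5.fst
    refine h6.unique ?_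
    refine ((hg.differentiable (by simp) (z : E)).hasFDerivAt).congr_of_eventuallyEq ?_
    filter_upwards [e.open_source.mem_nhds h0] with y hy using h1 y hy

theorem mfderiv_coe_injective (z : Z) :
    letI := chartedSpace g hg d hd Z hZ hsurj
    Function.Injective (mfderiv (𝓡 d) 𝓘(ℝ, E) ((↑) : Z → E) z) := by
  let := chartedSpace g hg d hd Z hZ hsurj
  obtain ⟨-, h2, -⟩ := fderiv_flattening (hg := hg) (hd := hd) (hsurj := hsurj) z
  rw [mfderiv_coe z]
  intro u v huv
  have h3 := congrArg (fderiv ℝ (flattening g hg d hd z (hsurj z z.2)) z) huv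
  have h4 := (DFunLike.congr_fun h2 (0, u)).symm.trans (h3.trans (DFunLike.congr_fun h2 (0, v)))
  exact congrArg Prod.snd h4

/-- The first component of the flattening is `g`, so its derivative carries the kernel of `dg` onto
`{0} × ℝ^d`, the vectors coming from the chart. -/
theorem exists_mfderiv_coe_eq_iff (z : Z) (X : E) :
    letI := chartedSpace g hg d hd Z hZ hsurj
    (∃ v : TangentSpace (𝓡 d) z, mfderiv (𝓡 d) 𝓘(ℝ, E) ((↑) : Z → E) z v = X) ↔
      fderiv ℝ g z X = 0 := by
  let := chartedSpace g hg d hd Z hZ hsurj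
  obtain ⟨h1, h2, h3⟩ := fderiv_flattening (hg := hg) (hd := hd) (hsurj := hsurj) z
  rw [mfderiv_coe z, ← h3]
  constructor
  · rintro ⟨v, rfl⟩
    exact congrArg Prod.fst (DFunLike.congr_fun h2 (0, v))
  · intro h
    refine ⟨(fderiv ℝ (flattening g hg d hd z (hsurj z z.2)) z X).2, ?_⟩
    refine Eq.trans ?_ (DFunLike.congr_fun h1 X)
    refine congrArg (fderiv ℝ (flattening g hg d hd z (hsurj z z.2)).symm
      (flattening g hg d hd z (hsurj z z.2) z)) (Prod.ext ?_ rfl)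
    exact h.symm

/-- The charts of `Z` are restrictions of maps analytic on open sets of the ambient space, so
regularity can be tested after inclusion. -/
theorem contMDiffWithinAt_of_coe {E' : Type*} [NormedAddCommGroup E'] [NormedSpace ℝ E']
    {H' : Type*} [TopologicalSpace H'] {I' : ModelWithCorners ℝ E' H'} {M' : Type*}
    [TopologicalSpace M'] [ChartedSpace H' M'] {n : ℕ∞ω} {f : M' → Z} {s : Set M'} {x : M'}
    (hf : ContMDiffWithinAt I' 𝓘(ℝ, E) n (fun y => (f y : E)) s x) :
    letI := chartedSpace g hg d hd Z hZ hsurj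
    ContMDiffWithinAt I' (𝓡 d) n f s x := by
  let := chartedSpace g hg d hd Z hZ hsurj
  obtain ⟨h0, h1, h2, h3⟩ := flattening_spec hg hd (f x) (hsurj _ (f x).2)
  have := (isManifold g hg d hd Z hZ hsurj).of_le (le_top : n ≤ ω)
  rw [contMDiffWithinAt_iff_target]
  refine ⟨Topology.IsInducing.subtypeVal.continuousWithinAt_iff.2 hf.continuousWithinAt, ?_⟩
  have h4 : ContDiffAt ℝ n (fun y => (flattening g hg d hd (f x) (hsurj _ (f x).2) y).2)
      (f x : E) := ((h2.contDiffAt ((flattening g hg d hd (f x) _).open_source.mem_nhds h0)).snd).of_le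
    (le_top : n ≤ ω)
  exact h4.contMDiffAt.comp_contMDiffWithinAt (f := fun y => (f y : E)) x hf

end RegularZeroSet

/-! ### Tangent vectors of `S¹ × M_+` inside `ℂ × ℝ^{2l}` -/

namespace CliffordSystem

section Tangent

variable {m l : ℕ} (C : CliffordSystem m l)

theorem contMDiff_focal_coe :
    ContMDiff (𝓡 (2 * l - (m + 2))) 𝓘(ℝ, EuclideanSpace ℝ (Fin (2 * l))) ω
      ((↑) : C.focal → EuclideanSpace ℝ (Fin (2 * l))) :=
  RegularZeroSet.contMDiff_coe

theorem contMDiffWithinAt_focal {E' : Type*} [NormedAddCommGroup E'] [NormedSpace ℝ E']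
    {H' : Type*} [TopologicalSpace H'] {I' : ModelWithCorners ℝ E' H'} {M' : Type*}
    [TopologicalSpace M'] [ChartedSpace H' M'] {n : ℕ∞ω} {f : M' → C.focal} {s : Set M'} {x : M'}
    (hf : ContMDiffWithinAt I' 𝓘(ℝ, EuclideanSpace ℝ (Fin (2 * l))) n
      (fun y => (f y : EuclideanSpace ℝ (Fin (2 * l)))) s x) :
    ContMDiffWithinAt I' (𝓡 (2 * l - (m + 2))) n f s x :=
  RegularZeroSet.contMDiffWithinAt_of_coe hf

theorem contMDiff_circle_coe : ContMDiff (𝓡 1) 𝓘(ℝ, ℂ) ω (fun a : Circle => (a : ℂ)) :=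
  haveI := finrank_real_complex_fact'
  contMDiff_coe_sphere (E := ℂ)

theorem contMDiff_incl : ContMDiff C.modelN 𝓘(ℝ, ℂ × EuclideanSpace ℝ (Fin (2 * l))) ω C.incl :=
  (contMDiff_circle_coe.comp contMDiff_fst).prodMk_space (C.contMDiff_focal_coe.comp contMDiff_snd)

theorem dincl_apply (p : C.N) (v : TangentSpace C.modelN p) :
    C.dincl p v = (mfderiv (𝓡 1) 𝓘(ℝ, ℂ) (fun a : Circle => (a : ℂ)) p.1 v.1,
      mfderiv (𝓡 (2 * l - (m + 2))) 𝓘(ℝ, EuclideanSpace ℝ (Fin (2 * l)))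
        ((↑) : C.focal → EuclideanSpace ℝ (Fin (2 * l))) p.2 v.2) := by
  have h1 : MDifferentiableAt (𝓡 1) 𝓘(ℝ, ℂ) (fun a : Circle => (a : ℂ)) p.1 :=
    (contMDiff_circle_coe p.1).mdifferentiableAt (by simp)
  have h2 : MDifferentiableAt (𝓡 (2 * l - (m + 2))) 𝓘(ℝ, EuclideanSpace ℝ (Fin (2 * l)))
      ((↑) : C.focal → EuclideanSpace ℝ (Fin (2 * l))) p.2 :=
    (C.contMDiff_focal_coe p.2).mdifferentiableAt (by simp)
  have h3 := h1.hasMFDerivAt.comp p (hasMFDerivAt_fst (I' := 𝓡 (2 * l - (m + 2))) p)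
  have h4 := h2.hasMFDerivAt.comp p (hasMFDerivAt_snd (I := 𝓡 1) p)
  have h : HasMFDerivAt C.modelN 𝓘(ℝ, ℂ × EuclideanSpace ℝ (Fin (2 * l))) C.incl p _ :=
    ⟨h3.1.prodMk h4.1, h3.2.prodMk h4.2⟩
  exact DFunLike.congr_fun h.mfderiv v

theorem dincl_injective (p : C.N) : Function.Injective (C.dincl p) := by
  have := finrank_real_complex_fact'
  intro u v huv
  rw [dincl_apply, dincl_apply] at huv
  exact Prod.ext (injective_mvfderiv_subtypeVal_sphere (E := ℂ) p.1 (congrArg Prod.fst huv))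
    (RegularZeroSet.mfderiv_coe_injective p.2 (congrArg Prod.snd huv))

theorem exists_dincl_eq_iff (p : C.N) (s : ℂ) (X : EuclideanSpace ℝ (Fin (2 * l))) :
    (∃ v, C.dincl p v = (s, X)) ↔ inner ℝ (p.1 : ℂ) s = 0 ∧
      inner ℝ (p.2 : EuclideanSpace ℝ (Fin (2 * l))) X = 0 ∧
      ∀ i, inner ℝ (C.op i p.2) X = 0 := by
  have := finrank_real_complex_fact'
  have h1 : (∃ v : TangentSpace (𝓡 1) p.1,
      mfderiv (𝓡 1) 𝓘(ℝ, ℂ) (fun a : Circle => (a : ℂ)) p.1 v = s) ↔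
      inner ℝ (p.1 : ℂ) s = 0 := by
    have h := range_mvfderiv_subtypeVal (E := ℂ) (n := 1) p.1
    rw [← Submodule.mem_orthogonal_singleton_iff_inner_right]
    have h2 := SetLike.ext_iff.1 h s
    exact h2
  have h2 := RegularZeroSet.exists_mfderiv_coe_eq_iff (hg := C.contDiff_defining)
    (hd := (by simp; omega : _ = 2 * l - (m + 2))) (hZ := C.mem_focal_iff)
    (hsurj := C.range_fderiv_defining) p.2 X
  rw [fderiv_defining_apply] at h2
  have h3 : ((2 * inner ℝ (p.2 : EuclideanSpace ℝ (Fin (2 * l))) X,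
      fun i => 2 * inner ℝ (C.op i p.2) X) : ℝ × (Fin (m + 1) → ℝ)) = 0 ↔
      inner ℝ (p.2 : EuclideanSpace ℝ (Fin (2 * l))) X = 0 ∧
      ∀ i, inner ℝ (C.op i p.2) X = 0 := by
    simp [Prod.ext_iff, funext_iff]
  rw [← h1, ← h3, ← h2]
  constructor
  · rintro ⟨v, hv⟩
    rw [dincl_apply] at hv
    exact ⟨⟨v.1, congrArg Prod.fst hv⟩, ⟨v.2, congrArg Prod.snd hv⟩⟩
  · rintro ⟨⟨v, hv⟩, ⟨w, hw⟩⟩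
    exact ⟨(v, w), (C.dincl_apply p (v, w)).trans (Prod.ext hv hw)⟩

end Tangent

/-! ### The operator `P_0 P_1`, and `J` in ambient terms -/

variable {l : ℕ} (C : CliffordSystem 1 l)

local notation "𝔼" => EuclideanSpace ℝ (Fin (2 * l))

/-- The orthogonal complex structure `P_0 P_1` of `ℝ^{2l}`. -/
def T : EuclideanSpace ℝ (Fin (2 * l)) →L[ℝ] EuclideanSpace ℝ (Fin (2 * l)) :=
  (C.op 0).comp (C.op 1)

theorem op_self {m : ℕ} (C : CliffordSystem m l) (i : Fin (m + 1))
    (x : EuclideanSpace ℝ (Fin (2 * l))) : C.op i (C.op i x) = x := by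
  have h := C.op_op i i x
  rw [if_pos rfl, ← two_smul ℝ] at h
  exact smul_right_injective _ (two_ne_zero' ℝ) h

theorem op_one_op_zero (x : 𝔼) : C.op 1 (C.op 0 x) = -C.T x := by
  have h := C.op_op 1 0 x
  rw [if_neg (by decide)] at h
  exact eq_neg_of_add_eq_zero_left h

theorem op_zero_T (x : 𝔼) : C.op 0 (C.T x) = C.op 1 x := C.op_self 0 _

theorem op_one_T (x : 𝔼) : C.op 1 (C.T x) = -C.op 0 x := by
  have h : C.T x = -C.op 1 (C.op 0 x) := by rw [op_one_op_zero, neg_neg]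
  rw [h, map_neg, op_self]

theorem T_T (x : 𝔼) : C.T (C.T x) = -x := by
  change C.op 0 (C.op 1 (C.T x)) = _
  rw [op_one_T, map_neg, op_self]

theorem inner_T_left (x y : 𝔼) : inner ℝ (C.T x) y = -inner ℝ x (C.T y) := by
  change inner ℝ (C.op 0 (C.op 1 x)) y = _
  rw [op_symm, op_symm, op_one_op_zero, inner_neg_right]

theorem inner_T_T (x y : 𝔼) : inner ℝ (C.T x) (C.T y) = inner ℝ x y := by
  rw [inner_T_left, T_T, inner_neg_right, neg_neg]

theorem inner_T_self (x : 𝔼) : inner ℝ x (C.T x) = 0 := by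
  have h := C.inner_T_left x x
  rw [real_inner_comm] at h
  linarith

variable {C} in
theorem inner_self_of_mem_focal {x : 𝔼} (hx : x ∈ C.focal) : inner ℝ x x = 1 := by
  rw [real_inner_self_eq_norm_sq, hx.1]; norm_num

variable {C} in
theorem inner_op_of_mem_focal {x : 𝔼} (hx : x ∈ C.focal) (i : Fin 2) :
    inner ℝ (C.op i x) x = 0 :=
  congrFun (congrArg Prod.snd ((C.mem_focal_iff x).1 hx)) i

/-- The endomorphism of `ℂ × ℝ^{2l}` that restricts to `J` on the tangent space of `S¹ × M_+`. -/
def ambientJ (q : ℂ × EuclideanSpace ℝ (Fin (2 * l))) :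
    ℂ × EuclideanSpace ℝ (Fin (2 * l)) →L[ℝ] ℂ × EuclideanSpace ℝ (Fin (2 * l)) :=
  ((-((innerSL ℝ (C.T q.2)).comp (.snd ℝ _ _))).smulRight (Complex.I * q.1)).prod
    ((C.T).comp (.snd ℝ _ _) + ((innerSL ℝ (C.T q.2)).comp (.snd ℝ _ _)).smulRight q.2 +
      ((innerSL ℝ (Complex.I * q.1)).comp (.fst ℝ _ _)).smulRight (C.T q.2))

theorem ambientJ_apply (q w : ℂ × EuclideanSpace ℝ (Fin (2 * l))) :
    C.ambientJ q w = (-(inner ℝ (C.T q.2) w.2) • (Complex.I * q.1),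
      C.T w.2 + inner ℝ (C.T q.2) w.2 • q.2 + inner ℝ (Complex.I * q.1) w.1 • C.T q.2) :=
  rfl

theorem contDiff_ambientJ : ContDiff ℝ ∞ C.ambientJ := by
  rw [contDiff_clm_apply_iff]
  intro w
  simp only [ambientJ_apply]
  have h1 : ContDiff ℝ ∞ (fun q : ℂ × 𝔼 => C.T q.2) := C.T.contDiff.comp contDiff_snd
  have h2 : ContDiff ℝ ∞ (fun q : ℂ × 𝔼 => Complex.I * q.1) := contDiff_const.mul contDiff_fst
  exact ((h1.inner ℝ contDiff_const).neg.smul h2).prodMk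
    ((contDiff_const.add ((h1.inner ℝ contDiff_const).smul contDiff_snd)).add
      ((h2.inner ℝ contDiff_const).smul h1))

theorem inner_I_mul_self (a : Circle) : inner ℝ (Complex.I * a : ℂ) (Complex.I * a) = (1 : ℝ) := by
  rw [real_inner_self_eq_norm_sq, norm_mul, Complex.norm_I, Circle.norm_coe]; norm_num

theorem inner_coe_I_mul (a : Circle) : inner ℝ (a : ℂ) (Complex.I * a) = (0 : ℝ) := by
  simp [Complex.inner]; ring

theorem eq_smul_of_inner_eq_zero (a : Circle) {s : ℂ} (h : inner ℝ (a : ℂ) s = 0) :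
    s = inner ℝ (Complex.I * a : ℂ) s • (Complex.I * a : ℂ) := by
  have h1 : (a : ℂ).re * (a : ℂ).re + (a : ℂ).im * (a : ℂ).im = 1 := by
    have := Circle.normSq_coe a
    rwa [Complex.normSq_apply] at this
  simp only [Complex.inner, Complex.mul_re, Complex.conj_re, Complex.conj_im] at h
  apply Complex.ext
  · simp [Complex.inner]
    linear_combination (-s.re) * h1 + (a : ℂ).re * h
  · simp [Complex.inner]
    linear_combination (-s.im) * h1 + (a : ℂ).im * h

variable {C} in
/-- Tangent vectors of `S¹ × M_+`, described as pairs in `ℂ × ℝ^{2l}`. -/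
structure IsTangent (p : C.N) (w : ℂ × EuclideanSpace ℝ (Fin (2 * l))) : Prop where
  fst : inner ℝ (p.1 : ℂ) w.1 = 0
  snd : inner ℝ (p.2 : EuclideanSpace ℝ (Fin (2 * l))) w.2 = 0
  op : ∀ i, inner ℝ (C.op i p.2) w.2 = 0

theorem isTangent_iff (p : C.N) (w : ℂ × 𝔼) : IsTangent p w ↔ ∃ v, C.dincl p v = w := by
  rw [← Prod.mk.eta (p := w), exists_dincl_eq_iff]
  exact ⟨fun h => ⟨h.1, h.2, h.3⟩, fun h => ⟨h.1, h.2.1, h.2.2⟩⟩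

theorem isTangent_dincl (p : C.N) (v : TangentSpace C.modelN p) : IsTangent p (C.dincl p v) :=
  (C.isTangent_iff p _).2 ⟨v, rfl⟩

theorem isTangent_eta (p : C.N) : IsTangent p (0, C.T p.2) where
  fst := inner_zero_right _
  snd := C.inner_T_self _
  op := by
    rw [Fin.forall_fin_two]
    constructor
    · rw [C.op_symm, op_zero_T, real_inner_comm, inner_op_of_mem_focal p.2.2]
    · rw [C.op_symm, op_one_T, inner_neg_right, real_inner_comm, inner_op_of_mem_focal p.2.2,
        neg_zero]

theorem isTangent_epsilon (p : C.N) : IsTangent p (Complex.I * p.1, 0) where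
  fst := inner_coe_I_mul _
  snd := inner_zero_right _
  op _ := inner_zero_right _

variable {C} in
-- Composition with `T` exchanges, up to sign, the tangency conditions for `P_0` and `P_1`. It
-- breaks only the condition of being orthogonal to `x`: since `⟨x, T X⟩ = -⟨T x, X⟩`, the term `⟨T
-- x, X⟩ x` in `ambientJ` removes exactly that radial part.
theorem IsTangent.ambientJ {p : C.N} {w : ℂ × 𝔼} (hw : IsTangent p w) :
    IsTangent p (C.ambientJ (C.incl p) w) := by
  have h := C.isTangent_eta p
  refine ⟨?_, ?_, ?_⟩
  · simp only [ambientJ_apply, incl, real_inner_smul_right, inner_coe_I_mul, mul_zero]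
  · have h1 := C.inner_T_left p.2 w.2
    simp only [ambientJ_apply, incl, real_inner_smul_right, inner_add_right,
      inner_self_of_mem_focal p.2.2, C.inner_T_self]
    linarith
  · have h2 := h.op
    have h3 := fun i => inner_op_of_mem_focal p.2.2 i
    have h4 := hw.op
    rw [Fin.forall_fin_two] at h2 h3 h4 ⊢
    simp only [ambientJ_apply, incl, real_inner_smul_right, inner_add_right, h2, h3]
    refine ⟨?_, ?_⟩
    · rw [C.op_symm, op_zero_T, ← C.op_symm, h4.2]; simp
    · rw [C.op_symm, op_one_T, inner_neg_right, ← C.op_symm, h4.1]; simp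

variable {C} in
theorem IsTangent.ambientJ_ambientJ {p : C.N} {w : ℂ × 𝔼} (hw : IsTangent p w) :
    C.ambientJ (C.incl p) (C.ambientJ (C.incl p) w) = -w := by
  have h1 : inner ℝ (C.T p.2) (p.2 : 𝔼) = 0 := by rw [real_inner_comm, inner_T_self]
  have h2 := C.inner_T_T p.2 p.2
  rw [inner_self_of_mem_focal p.2.2] at h2
  have h3 := eq_smul_of_inner_eq_zero p.1 hw.fst
  have h4 : inner ℝ (C.T p.2) (C.T w.2) = 0 := by rw [inner_T_T, hw.snd]
  simp only [ambientJ_apply, incl, inner_add_right, real_inner_smul_right, h1, h2, h4,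
    inner_I_mul_self, map_add, map_smul, T_T]
  refine Prod.ext ?_ ?_
  · simp only [mul_zero, mul_one, zero_add, Prod.fst_neg, neg_smul]
    rw [← h3]
  · simp only [Prod.snd_neg]
    module

variable {C} in
theorem IsTangent.inner_ambientJ {p : C.N} {w w' : ℂ × 𝔼} (hw : IsTangent p w)
    (hw' : IsTangent p w') :
    inner ℝ (C.ambientJ (C.incl p) w).1 (C.ambientJ (C.incl p) w').1 +
      inner ℝ (C.ambientJ (C.incl p) w).2 (C.ambientJ (C.incl p) w').2 =
    inner ℝ w.1 w'.1 + inner ℝ w.2 w'.2 := by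
  have h1 : inner ℝ (C.T p.2) (p.2 : 𝔼) = 0 := by rw [real_inner_comm, inner_T_self]
  have h2 := C.inner_T_T p.2 p.2
  rw [inner_self_of_mem_focal p.2.2] at h2
  have h3 : inner ℝ w.1 w'.1 =
      inner ℝ (Complex.I * p.1 : ℂ) w.1 * inner ℝ (Complex.I * p.1 : ℂ) w'.1 := by
    conv_lhs => rw [eq_smul_of_inner_eq_zero p.1 hw.fst]
    rw [real_inner_smul_left]
  have h4 : inner ℝ (C.T p.2) (C.T w'.2) = 0 := by rw [inner_T_T, hw'.snd]
  have h5 : inner ℝ (C.T w.2) (C.T p.2) = 0 := by rw [inner_T_T, real_inner_comm, hw.snd]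
  have h6 : inner ℝ (p.2 : 𝔼) (C.T w'.2) = -inner ℝ (C.T p.2) w'.2 := by
    rw [inner_T_left, neg_neg]
  have h7 : inner ℝ (C.T w.2) (p.2 : 𝔼) = -inner ℝ (C.T p.2) w.2 := by
    rw [inner_T_left, real_inner_comm]
  rw [h3]
  simp only [ambientJ_apply, incl, inner_add_right, inner_add_left, real_inner_smul_right,
    real_inner_smul_left, h1, h2, h4, h5, h6, h7, inner_I_mul_self, inner_T_T,
    C.inner_T_self, inner_self_of_mem_focal p.2.2]
  ring

/-- The three relations prescribe `J` on `ε`, on `η` and on `V`, which together span the tangent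
space; `ambientJ` is the one formula that agrees with all of them. -/
theorem isCliffordJ_iff (J : ∀ p : C.N, TangentSpace C.modelN p →L[ℝ] TangentSpace C.modelN p) :
    C.IsCliffordJ J ↔
      ∀ p v, C.dincl p (J p v) = C.ambientJ (C.incl p) (C.dincl p v) := by
  constructor
  · intro h p v
    have hw := C.isTangent_dincl p v
    set w := C.dincl p v with hwdef
    have h2 := C.inner_T_T p.2 p.2
    rw [inner_self_of_mem_focal p.2.2] at h2
    have h3 := eq_smul_of_inner_eq_zero p.1 hw.fst
    set t := inner ℝ (Complex.I * p.1 : ℂ) w.1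
    set c := inner ℝ (C.T p.2) w.2 with hc
    -- The `V`-component of `w`: as `η` is a unit vector, its coefficient is `c`, and likewise `t`
    -- is the coefficient of `ε`.
    have hV : IsTangent p (0, w.2 - c • C.T p.2) := by
      have h4 := C.isTangent_eta p
      refine ⟨inner_zero_right _, ?_, fun i => ?_⟩
      · simp [inner_sub_right, real_inner_smul_right, hw.snd, h4.snd]
      · simp [inner_sub_right, real_inner_smul_right, hw.op i, h4.op i]
    obtain ⟨v₁, hv₁⟩ := (C.isTangent_iff p _).1 (C.isTangent_epsilon p)
    obtain ⟨v₂, hv₂⟩ := (C.isTangent_iff p _).1 (C.isTangent_eta p)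
    obtain ⟨v₃, hv₃⟩ := (C.isTangent_iff p _).1 hV
    have hv : v = t • v₁ + c • v₂ + v₃ := by
      apply C.dincl_injective p
      rw [map_add, map_add, map_smul, map_smul, hv₁, hv₂, hv₃, ← hwdef]
      refine Prod.ext ?_ ?_
      · simpa using h3
      · simp
    have e₁ := h.map_epsilon p v₁ hv₁
    have e₂ := h.map_eta p v₂ hv₂
    have e₃ := h.map_V p v₃ _ hv₃ (by
      change inner ℝ _ (C.T p.2) = 0
      rw [inner_sub_left, real_inner_smul_left, h2, real_inner_comm, ← hc]; ring)
    have e₄ : C.dincl p (J p v) =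
        t • C.dincl p (J p v₁) + c • C.dincl p (J p v₂) + C.dincl p (J p v₃) := by
      rw [hv]
      simp only [map_add, map_smul]
    rw [e₄, e₁, e₂, e₃]
    change t • ((0, C.T p.2) : ℂ × 𝔼) + c • (-(Complex.I * p.1), 0) +
      (0, C.T (w.2 - c • C.T p.2)) = (-c • _, C.T w.2 + c • (p.2 : 𝔼) + t • C.T p.2)
    refine Prod.ext ?_ ?_
    · simp [incl]
    · simp [T_T]
      abel
  · intro h
    have h1 : ∀ p : C.N, inner ℝ (C.T p.2) (C.T p.2) = (1 : ℝ) := fun p => by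
      rw [inner_T_T, inner_self_of_mem_focal p.2.2]
    refine ⟨fun p v hv => ?_, fun p v hv => ?_, fun p v X hv hX => ?_⟩
    · rw [h, hv, ambientJ_apply]
      simp only [incl, inner_zero_right, inner_I_mul_self]
      simp
      rfl
    · rw [h, hv, ambientJ_apply]
      change (-(inner ℝ (C.T p.2) (C.T p.2)) • (Complex.I * (p.1 : ℂ)), C.T (C.T p.2) +
        inner ℝ (C.T p.2) (C.T p.2) • (p.2 : 𝔼) + inner ℝ (Complex.I * (p.1 : ℂ)) 0 • _) = _
      simp only [h1, T_T, inner_zero_right]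
      simp
    · have h2 : inner ℝ (C.T p.2) X = 0 := by rw [real_inner_comm]; exact hX
      rw [h, hv, ambientJ_apply]
      simp only [incl, h2, inner_zero_right]
      simp
      rfl

theorem existsUnique_isCliffordJ :
    ∃! J : ∀ p : C.N, TangentSpace C.modelN p →L[ℝ] TangentSpace C.modelN p, C.IsCliffordJ J := by
  -- A left inverse of the differential pulls `ambientJ` back to the tangent space. The choice is
  -- harmless because `ambientJ` preserves tangency.
  have h : ∀ p : C.N, ∃ L : ℂ × 𝔼 →L[ℝ] TangentSpace C.modelN p,
      ∀ v, L (C.dincl p v) = v := fun p =>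
    ContinuousLinearMap.HasLeftInverse.of_injective_of_finiteDimensional
      (f := (C.dincl p : C.ModelN →L[ℝ] ℂ × 𝔼)) (C.dincl_injective p)
  choose L hL using h
  refine ⟨fun p => (L p).comp ((C.ambientJ (C.incl p)).comp (C.dincl p)), ?_, ?_⟩
  · refine (C.isCliffordJ_iff _).2 fun p v => ?_
    obtain ⟨u, hu⟩ := (C.isTangent_iff p _).1 (C.isTangent_dincl p v).ambientJ
    change C.dincl p (L p (C.ambientJ (C.incl p) (C.dincl p v))) = _
    rw [← hu, hL]
  · intro J hJ
    rw [isCliffordJ_iff] at hJ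
    funext p
    ext1 v
    change J p v = L p (C.ambientJ (C.incl p) (C.dincl p v))
    rw [← hJ, hL]

end CliffordSystem

/-! ### Linear and nonlinear complex coordinates -/

/-- A real vector space with an operator of square `-1` is a coordinate space `ℂ^n`. -/
theorem exists_complex_coordinates {E : Type*} [NormedAddCommGroup E] [NormedSpace ℝ E]
    [FiniteDimensional ℝ E] {n : ℕ} (hn : Module.finrank ℝ E = 2 * n) (T : E →L[ℝ] E)
    (hT : ∀ x, T (T x) = -x) :
    ∃ A : EuclideanSpace ℂ (Fin n) ≃L[ℝ] E, ∀ w, A (Complex.I • w) = T (A w) := by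
  have hT' : (T : E →ₗ[ℝ] E) * (T : E →ₗ[ℝ] E) = -1 := LinearMap.ext hT
  let f : ℂ →ₐ[ℝ] Module.End ℝ E := Complex.liftAux _ hT'
  let : Module ℂ E := Module.compHom E f.toRingHom
  have hsmul : ∀ (c : ℂ) (x : E), c • x = f c x := fun _ _ => rfl
  have : IsScalarTower ℝ ℂ E := ⟨fun r c x => by rw [hsmul, hsmul, map_smul]; rfl⟩
  have : FiniteDimensional ℂ E := FiniteDimensional.right ℝ ℂ E
  have h1 : Module.finrank ℂ (EuclideanSpace ℂ (Fin n)) = Module.finrank ℂ E := by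
    have h2 := Module.finrank_mul_finrank ℝ ℂ E
    rw [Complex.finrank_real_complex, hn] at h2
    rw [finrank_euclideanSpace, Fintype.card_fin]
    omega
  -- Only a linear isomorphism, not an isometry; lengths on the cone are therefore always measured
  -- after applying `coord`.
  let A := LinearEquiv.ofFinrankEq (EuclideanSpace ℂ (Fin n)) E h1
  refine ⟨(A.restrictScalars ℝ).toContinuousLinearEquiv, fun w => ?_⟩
  change A (Complex.I • w) = T (A w)
  rw [map_smul, hsmul]
  have h3 : f Complex.I = (T : E →ₗ[ℝ] E) := Complex.liftAux_apply_I _ hT'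
  rw [h3]
  rfl

/-- Around a point where the derivative of the holomorphic map `g` is onto, there is a holomorphic
coordinate system whose first component is `g`. -/
theorem exists_holomorphic_flattening {E F : Type*} [NormedAddCommGroup E] [NormedSpace ℂ E]
    [FiniteDimensional ℂ E] [NormedAddCommGroup F] [NormedSpace ℂ F] [CompleteSpace F]
    (g : E → F) (hg : ContDiff ℂ ω g) (d : ℕ) (x : E)
    (hsurj : (fderiv ℂ g x).range = ⊤)
    (hd : Module.finrank ℂ E - Module.finrank ℂ F = d) :
    ∃ e : OpenPartialHomeomorph E (F × EuclideanSpace ℂ (Fin d)),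
      x ∈ e.source ∧ (∀ y ∈ e.source, (e y).1 = g y) ∧
      ContDiffOn ℂ ω e e.source ∧ ContDiffOn ℂ ω e.symm e.target := by
  have : CompleteSpace E := FiniteDimensional.complete ℂ E
  have hs : HasStrictFDerivAt g (fderiv ℂ g x) x := hg.contDiffAt.hasStrictFDerivAt (by simp)
  have hker : Module.finrank ℂ (fderiv ℂ g x).ker =
      Module.finrank ℂ (EuclideanSpace ℂ (Fin d)) := by
    have h1 := LinearMap.finrank_range_add_finrank_ker (fderiv ℂ g x : E →ₗ[ℂ] F)
    have h2 : Module.finrank ℂ (LinearMap.range (fderiv ℂ g x : E →ₗ[ℂ] F)) =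
        Module.finrank ℂ F := by
      have : LinearMap.range (fderiv ℂ g x : E →ₗ[ℂ] F) = ⊤ := hsurj
      rw [this, finrank_top]
    have h3 : Module.finrank ℂ (fderiv ℂ g x).ker
        = Module.finrank ℂ (LinearMap.ker (fderiv ℂ g x : E →ₗ[ℂ] F)) := rfl
    rw [finrank_euclideanSpace, Fintype.card_fin]
    omega
  let L : (fderiv ℂ g x).ker ≃L[ℂ] EuclideanSpace ℂ (Fin d) :=
    ContinuousLinearEquiv.ofFinrankEq hker
  obtain ⟨p, hp⟩ : (fderiv ℂ g x).ker.ClosedComplemented :=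
    Submodule.ClosedComplemented.of_finiteDimensional_quotient
      (Submodule.closed_of_finiteDimensional _)
  let φ : ImplicitFunctionData ℂ E F (EuclideanSpace ℂ (Fin d)) :=
    { leftFun := g
      leftDeriv := fderiv ℂ g x
      rightFun := (L : (fderiv ℂ g x).ker →L[ℂ] EuclideanSpace ℂ (Fin d)).comp p
      rightDeriv := (L : (fderiv ℂ g x).ker →L[ℂ] EuclideanSpace ℂ (Fin d)).comp p
      pt := x
      hasStrictFDerivAt_leftFun := hs
      hasStrictFDerivAt_rightFun :=
        ((L : (fderiv ℂ g x).ker →L[ℂ] EuclideanSpace ℂ (Fin d)).comp p).hasStrictFDerivAt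
      range_leftDeriv := hsurj
      range_rightDeriv := by
        rw [LinearMap.range_eq_top]
        intro k
        exact ⟨(L.symm k : E), by simp [hp]⟩
      isCompl_ker := by
        have h1 : ((L : (fderiv ℂ g x).ker →L[ℂ] EuclideanSpace ℂ (Fin d)).comp p).ker = p.ker := by
          ext y; simp
        rw [h1]
        exact LinearMap.isCompl_of_proj hp }
  have hφ : ContDiff ℂ ω φ.prodFun :=
    hg.prodMk ((L : (fderiv ℂ g x).ker →L[ℂ] EuclideanSpace ℂ (Fin d)).comp p).contDiff
  have hω : (ω : ℕ∞ω) ≠ ∞ := by decide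
  refine ⟨φ.toOpenPartialHomeomorph.restrContDiff ℂ ω hω, ?_, fun y _ => rfl, ?_, ?_⟩
  · refine ⟨φ.pt_mem_toOpenPartialHomeomorph_source, hφ.contDiffAt, ?_⟩
    have h := φ.pt_mem_toOpenPartialHomeomorph_source
    have hinv : φ.toOpenPartialHomeomorph.symm (φ.toOpenPartialHomeomorph x) = x :=
      φ.toOpenPartialHomeomorph.left_inv h
    apply φ.toOpenPartialHomeomorph.contDiffAt_symm (φ.toOpenPartialHomeomorph.map_source h)
    · rw [hinv]
      exact φ.hasStrictFDerivAt.hasFDerivAt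
    · exact hφ.contDiffAt
  · exact φ.toOpenPartialHomeomorph.contDiffOn_restrContDiff_source ℂ hω
  · exact φ.toOpenPartialHomeomorph.contDiffOn_restrContDiff_target ℂ hω

/-! ### The complex quadric cone over `M_+` -/

namespace CliffordSystem

variable {l : ℕ} (C : CliffordSystem 1 l)

/-- Complex coordinates on `ℝ^{2l}`, in which `P_0 P_1` is multiplication by the imaginary unit. -/
def coord : EuclideanSpace ℂ (Fin l) ≃L[ℝ] EuclideanSpace ℝ (Fin (2 * l)) :=
  (exists_complex_coordinates (by simp) C.T C.T_T).choose

theorem coord_I_smul (w : EuclideanSpace ℂ (Fin l)) :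
    C.coord (Complex.I • w) = C.T (C.coord w) :=
  (exists_complex_coordinates (by simp) C.T C.T_T).choose_spec w

theorem coord_smul (c : ℂ) (w : EuclideanSpace ℂ (Fin l)) :
    C.coord (c • w) = c.re • C.coord w + c.im • C.T (C.coord w) := by
  have h : c • w = c.re • w + c.im • (Complex.I • w) := by
    conv_lhs => rw [← Complex.re_add_im c, add_smul, mul_smul]
    rfl
  rw [h, map_add, map_smul, map_smul, coord_I_smul]

theorem coord_symm_T (x : EuclideanSpace ℝ (Fin (2 * l))) :
    C.coord.symm (C.T x) = Complex.I • C.coord.symm x := by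
  rw [ContinuousLinearEquiv.symm_apply_eq, coord_I_smul, ContinuousLinearEquiv.apply_symm_apply]

/-- The complex bilinear form `⟨P_0 x, y⟩ - √-1 ⟨P_1 x, y⟩`, in complex coordinates. -/
def bilin : EuclideanSpace ℂ (Fin l) →L[ℂ] EuclideanSpace ℂ (Fin l) →L[ℂ] ℂ :=
  LinearMap.toContinuousLinearMap
    ((LinearMap.toContinuousLinearMap (𝕜 := ℂ) (E := EuclideanSpace ℂ (Fin l))
      (F' := ℂ)).toLinearMap ∘ₗ LinearMap.mk₂ ℂ (fun w w' =>
      (⟨inner ℝ (C.op 0 (C.coord w)) (C.coord w'),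
        -inner ℝ (C.op 1 (C.coord w)) (C.coord w')⟩ : ℂ))
      (fun w₁ w₂ w' => by
        apply Complex.ext
        · simp [inner_add_left]
        · simp [inner_add_left]; ring)
      (fun c w w' => by
        apply Complex.ext <;>
        simp [coord_smul, inner_add_left, real_inner_smul_left, op_zero_T, op_one_T] <;> ring)
      (fun w w₁' w₂' => by
        apply Complex.ext
        · simp [inner_add_right]
        · simp [inner_add_right]; ring)
      (fun c w w' => by
        have h0 : ∀ x y, inner ℝ (C.op 0 x) (C.T y) = inner ℝ (C.op 1 x) y := fun x y => by
          rw [op_symm, op_zero_T, op_symm]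
        have h1 : ∀ x y, inner ℝ (C.op 1 x) (C.T y) = -inner ℝ (C.op 0 x) y := fun x y => by
          rw [op_symm, op_one_T, inner_neg_right, op_symm]
        apply Complex.ext <;>
        simp [coord_smul, inner_add_right, real_inner_smul_right, h0, h1] <;> ring))

theorem bilin_apply (w w' : EuclideanSpace ℂ (Fin l)) :
    C.bilin w w' = ⟨inner ℝ (C.op 0 (C.coord w)) (C.coord w'),
        -inner ℝ (C.op 1 (C.coord w)) (C.coord w')⟩ :=
  rfl

theorem bilin_comm (w w' : EuclideanSpace ℂ (Fin l)) : C.bilin w w' = C.bilin w' w := by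
  rw [bilin_apply, bilin_apply, op_symm, op_symm,
    real_inner_comm (C.op 0 _) (C.coord w), real_inner_comm (C.op 1 _) (C.coord w)]

/-- The quadric cone over `M_+`, in complex coordinates. -/
def cone : Set (EuclideanSpace ℂ (Fin l)) := {w | C.bilin w w = 0}

theorem smul_mem_cone {w : EuclideanSpace ℂ (Fin l)} (hw : w ∈ C.cone) (c : ℂ) :
    c • w ∈ C.cone := by
  have h : C.bilin w w = 0 := hw
  change C.bilin (c • w) (c • w) = 0
  simp [h]

theorem mem_cone_iff (w : EuclideanSpace ℂ (Fin l)) :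
    w ∈ C.cone ↔ ∀ i, inner ℝ (C.op i (C.coord w)) (C.coord w) = 0 := by
  change C.bilin w w = 0 ↔ _
  rw [bilin_apply, Complex.ext_iff, Fin.forall_fin_two]
  simp

/-- The real and imaginary parts of `b(w, w)` are, up to sign, the two quadratic forms cutting `M_+`
out of the sphere. -/
theorem mem_focal_iff_cone (x : EuclideanSpace ℝ (Fin (2 * l))) :
    x ∈ C.focal ↔ ‖x‖ = 1 ∧ C.coord.symm x ∈ C.cone := by
  rw [mem_cone_iff, ContinuousLinearEquiv.apply_symm_apply]
  refine ⟨fun h => ⟨h.1, inner_op_of_mem_focal h⟩, fun h => ?_⟩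
  rw [C.mem_focal_iff, defining, real_inner_self_eq_norm_sq, h.1]
  exact Prod.ext (by norm_num) (funext h.2)

theorem hasFDerivAt_bilin (w : EuclideanSpace ℂ (Fin l)) :
    HasFDerivAt (fun w => C.bilin w w) ((2 : ℂ) • C.bilin w) w := by
  have h := C.bilin.hasFDerivAt (x := w) |>.clm_apply (hasFDerivAt_id w)
  refine h.congr_fderiv ?_
  ext1 v
  simp [C.bilin_comm v w, two_mul]

theorem contDiff_bilin_self : ContDiff ℂ ω (fun w => C.bilin w w) :=
  C.bilin.contDiff.clm_apply contDiff_id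

/-- The form `b` is nondegenerate, so the derivative `2 b(w, ·)` of the equation is nonzero, hence
onto `ℂ`, away from the vertex. -/
theorem exists_cone_flattening {w : EuclideanSpace ℂ (Fin l)} (hw : w ≠ 0) :
    ∃ e : OpenPartialHomeomorph (EuclideanSpace ℂ (Fin l)) (ℂ × EuclideanSpace ℂ (Fin (l - 1))),
      w ∈ e.source ∧ (∀ y ∈ e.source, (e y).1 = C.bilin y y) ∧
      ContDiffOn ℂ ω e e.source ∧ ContDiffOn ℂ ω e.symm e.target := by
  refine exists_holomorphic_flattening (fun w => C.bilin w w) C.contDiff_bilin_self _ w ?_ (by simp)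
  rw [(C.hasFDerivAt_bilin w).fderiv, LinearMap.range_eq_top]
  intro c
  -- Against the vector `P_0 w`, the real part of `b` is `|P_0 w|² = |w|²`.
  have h : C.bilin w (C.coord.symm (C.op 0 (C.coord w))) ≠ 0 := by
    rw [bilin_apply]
    intro h
    have h1 := congrArg Complex.re h
    simp only [ContinuousLinearEquiv.apply_symm_apply, Complex.zero_re] at h1
    rw [inner_op_op, if_pos rfl, inner_self_eq_zero] at h1
    exact hw (by simpa using h1)
  refine ⟨(c / (2 * C.bilin w (C.coord.symm (C.op 0 (C.coord w))))) •
    C.coord.symm (C.op 0 (C.coord w)), ?_⟩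
  simp
  field_simp

end CliffordSystem

/-! ### The local identification `(e^{√-1 θ}, x) ↦ e^θ x` with the cone -/

namespace CliffordSystem

variable {l : ℕ} (C : CliffordSystem 1 l)

/-- The map `(a, x) ↦ exp (arg (a / a₀)) x`, in complex coordinates on `ℝ^{2l}`. -/
def lift (a₀ : Circle) (q : ℂ × EuclideanSpace ℝ (Fin (2 * l))) : EuclideanSpace ℂ (Fin l) :=
  Real.exp (Complex.arg (q.1 / a₀)) • C.coord.symm q.2

/-- The angle is the imaginary part of the principal logarithm, which is analytic on the slit plane;
dividing by `a₀` moves the cut away from `a₀`. -/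
theorem contDiffAt_lift (a₀ : Circle) {q : ℂ × EuclideanSpace ℝ (Fin (2 * l))}
    (hq : q.1 / a₀ ∈ Complex.slitPlane) : ContDiffAt ℝ ω (C.lift a₀) q := by
  have h1 : ContDiffAt ℝ ω (fun q : ℂ × EuclideanSpace ℝ (Fin (2 * l)) => q.1 / (a₀ : ℂ)) q :=
    contDiffAt_fst.div_const _
  have h2 : ContDiffAt ℝ ω Complex.log (q.1 / a₀) :=
    (Complex.contDiffAt_log hq).restrict_scalars ℝ
  have h3 : ContDiffAt ℝ ω (fun q : ℂ × EuclideanSpace ℝ (Fin (2 * l)) =>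
      Complex.log (q.1 / (a₀ : ℂ))) q :=
    ContDiffAt.comp (f := fun q : ℂ × EuclideanSpace ℝ (Fin (2 * l)) => q.1 / (a₀ : ℂ)) q h2 h1
  have h4 : ContDiffAt ℝ ω (fun q : ℂ × EuclideanSpace ℝ (Fin (2 * l)) =>
      (Complex.log (q.1 / (a₀ : ℂ))).im) q := Complex.imCLM.contDiff.contDiffAt.comp q h3
  simp only [Complex.log_im] at h4
  exact h4.exp.smul (C.coord.symm.contDiff.contDiffAt.comp q contDiffAt_snd)

theorem fderiv_lift (a₀ : Circle) {q : ℂ × EuclideanSpace ℝ (Fin (2 * l))}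
    (hq : q.1 / a₀ ∈ Complex.slitPlane) (w : ℂ × EuclideanSpace ℝ (Fin (2 * l))) :
    fderiv ℝ (C.lift a₀) q w = Real.exp (Complex.arg (q.1 / a₀)) •
      ((w.1 / q.1).im • C.coord.symm q.2 + C.coord.symm w.2) := by
  have h1 : HasFDerivAt (fun q : ℂ × EuclideanSpace ℝ (Fin (2 * l)) => q.1 * (a₀ : ℂ)⁻¹)
      _ q := (hasFDerivAt_fst (𝕜 := ℝ)).mul_const (a₀ : ℂ)⁻¹
  have h2 : HasFDerivAt Complex.log _ (q.1 * (a₀ : ℂ)⁻¹) :=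
    (Complex.hasStrictFDerivAt_log_real (x := q.1 * (a₀ : ℂ)⁻¹) hq).hasFDerivAt
  have h3 := Complex.imCLM.hasFDerivAt.comp q (h2.comp q h1)
  have h4 := h3.exp.smul (C.coord.symm.hasFDerivAt.comp q (hasFDerivAt_snd (𝕜 := ℝ)))
  have h5 : HasFDerivAt (C.lift a₀) _ q :=
    h4.congr_of_eventuallyEq (Filter.Eventually.of_forall fun q => by
      simp [lift, Complex.log_im, div_eq_mul_inv])
  rw [h5.fderiv]
  have h6 : (a₀ : ℂ) ≠ 0 := Circle.coe_ne_zero a₀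
  have h7 : q.1 ≠ 0 := by
    rintro h
    rw [h, zero_div] at hq
    exact Complex.zero_notMem_slitPlane hq
  have h8 : (q.1 * (a₀ : ℂ)⁻¹)⁻¹ * ((a₀ : ℂ)⁻¹ * w.1) = w.1 / q.1 := by field_simp
  change Real.exp (Complex.log (q.1 * (a₀ : ℂ)⁻¹)).im • C.coord.symm w.2 +
    (Real.exp (Complex.log (q.1 * (a₀ : ℂ)⁻¹)).im •
      ((q.1 * (a₀ : ℂ)⁻¹)⁻¹ * ((a₀ : ℂ)⁻¹ * w.1)).im) • C.coord.symm q.2 = _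
  rw [h8, Complex.log_im, ← div_eq_mul_inv, smul_eq_mul, mul_smul, smul_add, add_comm]

/-- Infinitesimally, turning the circle by `ε` scales the cone radially along `x`, while `η` is the
direction `T x = √-1 x`; so `J ε = η` matches multiplication by `√-1`. The radial correction in
`ambientJ` cancels against the image of its circle component, leaving `T` on the rest. -/
theorem fderiv_lift_ambientJ (a₀ : Circle) {p : C.N} (hp : (p.1 / a₀ : ℂ) ∈ Complex.slitPlane)
    {w : ℂ × EuclideanSpace ℝ (Fin (2 * l))} (hw : IsTangent p w) :
    fderiv ℝ (C.lift a₀) (C.incl p) (C.ambientJ (C.incl p) w) =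
      Complex.I • fderiv ℝ (C.lift a₀) (C.incl p) w := by
  have ha : (p.1 : ℂ) ≠ 0 := Circle.coe_ne_zero p.1
  have him : (w.1 / p.1).im = inner ℝ (Complex.I * p.1 : ℂ) w.1 := by
    conv_lhs => rw [eq_smul_of_inner_eq_zero p.1 hw.fst]
    rw [Complex.real_smul, mul_div_assoc, mul_div_cancel_right₀ _ ha]
    simp [-Complex.inner]
  rw [C.fderiv_lift a₀ hp, C.fderiv_lift a₀ hp]
  have h2 : ((-(inner ℝ (C.T p.2) w.2) • (Complex.I * (p.1 : ℂ))) / p.1).im =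
      -inner ℝ (C.T p.2) w.2 := by
    rw [Complex.real_smul, mul_div_assoc, mul_div_cancel_right₀ _ ha]
    simp [-Complex.inner]
  simp only [ambientJ_apply, incl, him, h2, map_add, map_smul, coord_symm_T]
  rw [smul_comm Complex.I, smul_add Complex.I, smul_comm Complex.I]
  congr 1
  module

theorem coord_lift (a₀ : Circle) (y : C.N) : C.coord (C.lift a₀ (C.incl y)) =
    Real.exp (Complex.arg (y.1 / a₀)) • (y.2 : EuclideanSpace ℝ (Fin (2 * l))) := by
  rw [lift, map_smul, ContinuousLinearEquiv.apply_symm_apply]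
  rfl

theorem norm_coord_lift (a₀ : Circle) (y : C.N) :
    ‖C.coord (C.lift a₀ (C.incl y))‖ = Real.exp (Complex.arg (y.1 / a₀)) := by
  rw [coord_lift, norm_smul, y.2.2.1, mul_one, Real.norm_of_nonneg (Real.exp_nonneg _)]

theorem lift_mem_cone (a₀ : Circle) (y : C.N) : C.lift a₀ (C.incl y) ∈ C.cone := by
  have h := ((C.mem_focal_iff_cone y.2).1 y.2.2).2
  exact C.smul_mem_cone h (Real.exp (Complex.arg (y.1 / a₀)) : ℝ)

open Classical in
/-- The radial projection of the punctured cone onto `M_+`. -/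
def radial (x₀ : C.focal) (w : C.cone) : C.focal :=
  -- The value at the vertex is a dummy: the target of `toCone` excludes the vertex.
  if h : (w : EuclideanSpace ℂ (Fin l)) = 0 then x₀ else
    ⟨‖C.coord w‖⁻¹ • C.coord w, by
      have h1 : ‖C.coord w‖ ≠ 0 := by simpa using h
      rw [mem_focal_iff_cone, map_smul, ContinuousLinearEquiv.symm_apply_apply]
      refine ⟨?_, C.smul_mem_cone w.2 (‖C.coord w‖⁻¹ : ℝ)⟩
      rw [norm_smul, norm_inv, norm_norm, inv_mul_cancel₀ h1]⟩

theorem coe_radial (x₀ : C.focal) {w : C.cone} (hw : (w : EuclideanSpace ℂ (Fin l)) ≠ 0) :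
    (C.radial x₀ w : EuclideanSpace ℝ (Fin (2 * l))) = ‖C.coord w‖⁻¹ • C.coord w := by
  rw [radial, dif_neg hw]

theorem ne_zero_of_lt_norm_coord {w : EuclideanSpace ℂ (Fin l)} {c : ℝ}
    (h : Real.exp c < ‖C.coord w‖) : w ≠ 0 := by
  rintro rfl
  rw [map_zero, norm_zero] at h
  exact absurd h (Real.exp_pos _).le.not_gt

/-- The local identification of `S¹ × M_+` with the quadric cone. -/
def toCone (p : C.N) : OpenPartialHomeomorph C.N C.cone where
  toFun y := ⟨C.lift p.1 (C.incl y), C.lift_mem_cone p.1 y⟩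
  -- Since `|x| = 1`, the norm of `e^θ x` recovers the angle `θ` and its direction recovers `x`.
  invFun w := (p.1 * Circle.exp (Real.log ‖C.coord w‖), C.radial p.2 w)
  source := {y | (y.1 / p.1 : ℂ) ∈ Complex.slitPlane}
  -- On the slit plane the argument fills the open interval `(-π, π)`; this is its exponential.
  target := {w | Real.exp (-Real.pi) < ‖C.coord w‖ ∧ ‖C.coord w‖ < Real.exp Real.pi}
  map_source' y hy := by
    have h := Complex.mem_slitPlane_iff_arg.1 hy
    simp only [Set.mem_ofPred_eq, norm_coord_lift, Real.exp_lt_exp]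
    exact ⟨Complex.neg_pi_lt_arg _, lt_of_le_of_ne (Complex.arg_le_pi _) h.1⟩
  map_target' w hw := by
    have hpos : 0 < ‖C.coord w‖ := (Real.exp_pos _).trans hw.1
    simp only [Set.mem_ofPred_eq, Circle.coe_mul,
      mul_div_cancel_left₀ _ (Circle.coe_ne_zero p.1)]
    rw [Complex.mem_slitPlane_iff_arg, Circle.arg_exp]
    · refine ⟨ne_of_lt ?_, Circle.coe_ne_zero _⟩
      rw [Real.log_lt_iff_lt_exp hpos]
      exact hw.2
    · rw [Real.lt_log_iff_exp_lt hpos]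
      exact hw.1
    · rw [Real.log_le_iff_le_exp hpos]
      exact hw.2.le
  left_inv' y hy := by
    refine Prod.ext ?_ (Subtype.ext ?_)
    · simp only [norm_coord_lift, Real.log_exp]
      rw [← Circle.coe_div, Circle.exp_arg, mul_div_cancel]
    · have h0 : C.lift p.1 (C.incl y) ≠ 0 := by
        intro h
        have := C.norm_coord_lift p.1 y
        rw [h, map_zero, norm_zero] at this
        exact (Real.exp_pos _).ne this
      rw [C.coe_radial p.2 h0, norm_coord_lift, coord_lift, inv_smul_smul₀ (Real.exp_ne_zero _)]
  right_inv' w hw := by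
    have hpos : 0 < ‖C.coord w‖ := (Real.exp_pos _).trans hw.1
    apply Subtype.ext
    apply C.coord.injective
    simp only [coord_lift, Circle.coe_mul, mul_div_cancel_left₀ _ (Circle.coe_ne_zero p.1)]
    rw [Circle.arg_exp, Real.exp_log hpos, C.coe_radial p.2 (C.ne_zero_of_lt_norm_coord hw.1),
      smul_inv_smul₀ hpos.ne']
    · rw [Real.lt_log_iff_exp_lt hpos]
      exact hw.1
    · rw [Real.log_le_iff_le_exp hpos]
      exact hw.2.le
  open_source := Complex.isOpen_slitPlane.preimage (by fun_prop)
  open_target := by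
    exact (isOpen_Ioo (a := Real.exp (-Real.pi)) (b := Real.exp Real.pi)).preimage
      (f := fun w : C.cone => ‖C.coord w‖) (by fun_prop)
  continuousOn_toFun := by
    rw [Topology.IsInducing.subtypeVal.continuousOn_iff]
    intro y hy
    exact ((C.contDiffAt_lift p.1 (q := C.incl y) hy).continuousAt.comp
      C.contMDiff_incl.continuous.continuousAt).continuousWithinAt
  continuousOn_invFun := by
    have hc : Continuous fun w : C.cone => C.coord w := by fun_prop
    have h0 : ∀ w ∈ {w : C.cone | Real.exp (-Real.pi) < ‖C.coord w‖ ∧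
        ‖C.coord w‖ < Real.exp Real.pi}, ‖C.coord w‖ ≠ 0 :=
      fun w hw => ((Real.exp_pos _).trans hw.1).ne'
    refine ContinuousOn.prodMk ?_ ?_
    · exact continuousOn_const.mul
        (Circle.exp.continuous.comp_continuousOn (hc.norm.continuousOn.log h0))
    · rw [Topology.IsInducing.subtypeVal.continuousOn_iff]
      refine ContinuousOn.congr (f := fun w : C.cone => ‖C.coord w‖⁻¹ • C.coord w) ?_ ?_
      · exact (hc.norm.continuousOn.inv₀ h0).smul hc.continuousOn
      · intro w hw
        exact C.coe_radial p.2 (C.ne_zero_of_lt_norm_coord hw.1)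

end CliffordSystem

/-! ### Holomorphic charts and integrability -/

namespace CliffordSystem

variable {l : ℕ} (C : CliffordSystem 1 l)

theorem lift_ne_zero (a₀ : Circle) (y : C.N) : C.lift a₀ (C.incl y) ≠ 0 := by
  intro h
  have h1 := C.norm_coord_lift a₀ y
  rw [h, map_zero, norm_zero] at h1
  exact (Real.exp_pos _).ne h1

/-- Holomorphic coordinates around the image of `p` in the quadric cone, the first of which is the
equation of the cone. -/
def coneFlattening (p : C.N) :
    OpenPartialHomeomorph (EuclideanSpace ℂ (Fin l)) (ℂ × EuclideanSpace ℂ (Fin (l - 1))) :=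
  (C.exists_cone_flattening (C.lift_ne_zero p.1 p)).choose

theorem coneFlattening_spec (p : C.N) :
    C.lift p.1 (C.incl p) ∈ (C.coneFlattening p).source ∧
    (∀ y ∈ (C.coneFlattening p).source, (C.coneFlattening p y).1 = C.bilin y y) ∧
    ContDiffOn ℂ ω (C.coneFlattening p) (C.coneFlattening p).source ∧
    ContDiffOn ℂ ω (C.coneFlattening p).symm (C.coneFlattening p).target :=
  (C.exists_cone_flattening (C.lift_ne_zero p.1 p)).choose_spec

theorem mem_cone_iff_coneFlattening (p : C.N) :
    ∀ y ∈ (C.coneFlattening p).source, y ∈ C.cone ↔ (C.coneFlattening p y).1 = 0 := by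
  intro y hy
  rw [(C.coneFlattening_spec p).2.1 y hy]
  rfl

/-- The chart of the quadric cone around the image of `p`. -/
def coneChart (p : C.N) : OpenPartialHomeomorph C.cone (EuclideanSpace ℂ (Fin (l - 1))) :=
  RegularZeroSet.sliceChart C.cone (C.coneFlattening p) (C.mem_cone_iff_coneFlattening p)
    -- Default value of the inverse chart outside its target.
    (C.toCone p p)

/-- The holomorphic chart of `S¹ × M_+` around `p`. -/
def holoChart (p : C.N) : OpenPartialHomeomorph C.N (EuclideanSpace ℂ (Fin (l - 1))) :=
  (C.toCone p).trans (C.coneChart p)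

theorem mem_holoChart_source_iff {p y : C.N} : y ∈ (C.holoChart p).source ↔
    (y.1 / p.1 : ℂ) ∈ Complex.slitPlane ∧
      C.lift p.1 (C.incl y) ∈ (C.coneFlattening p).source := by
  rw [holoChart, OpenPartialHomeomorph.trans_source]
  rfl

theorem mem_holoChart_source (p : C.N) : p ∈ (C.holoChart p).source := by
  rw [mem_holoChart_source_iff, div_self (Circle.coe_ne_zero p.1)]
  exact ⟨Complex.one_mem_slitPlane, (C.coneFlattening_spec p).1⟩

theorem mem_coneFlattening_target {p : C.N} {k : EuclideanSpace ℂ (Fin (l - 1))}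
    (hk : k ∈ (C.holoChart p).target) :
    ((0, k) : ℂ × EuclideanSpace ℂ (Fin (l - 1))) ∈ (C.coneFlattening p).target := by
  rw [holoChart, OpenPartialHomeomorph.trans_target] at hk
  exact hk.1

theorem coneChart_symm_mem {p : C.N} {k : EuclideanSpace ℂ (Fin (l - 1))}
    (hk : k ∈ (C.holoChart p).target) : (C.coneChart p).symm k ∈ (C.toCone p).target := by
  rw [holoChart, OpenPartialHomeomorph.trans_target] at hk
  exact hk.2

theorem coe_coneChart_symm {p : C.N} {k : EuclideanSpace ℂ (Fin (l - 1))}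
    (hk : k ∈ (C.holoChart p).target) :
    ((C.coneChart p).symm k : EuclideanSpace ℂ (Fin l)) = (C.coneFlattening p).symm (0, k) :=
  RegularZeroSet.sliceChart_coe_symm _ _ _ _ (C.mem_coneFlattening_target hk)

/-- After lifting to the cone, the inverse chart is a slice of a holomorphic map, although the lift
itself is only real analytic. Holomorphy of the transitions rests on this. -/
theorem lift_holoChart_symm {p : C.N} {k : EuclideanSpace ℂ (Fin (l - 1))}
    (hk : k ∈ (C.holoChart p).target) :
    C.lift p.1 (C.incl ((C.holoChart p).symm k)) = (C.coneFlattening p).symm (0, k) := by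
  rw [← C.coe_coneChart_symm hk]
  exact congrArg Subtype.val ((C.toCone p).right_inv (C.coneChart_symm_mem hk))

/-- The expression of the holomorphic chart around `p` in the ambient space `ℂ × ℝ^{2l}`. -/
def ambientChart (p : C.N) (q : ℂ × EuclideanSpace ℝ (Fin (2 * l))) :
    EuclideanSpace ℂ (Fin (l - 1)) :=
  (C.coneFlattening p (C.lift p.1 q)).2

theorem holoChart_eq (p : C.N) : (C.holoChart p : C.N → _) = C.ambientChart p ∘ C.incl := rfl

theorem contDiffAt_ambientChart {p y : C.N} (hy : y ∈ (C.holoChart p).source) :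
    ContDiffAt ℝ ω (C.ambientChart p) (C.incl y) := by
  rw [mem_holoChart_source_iff] at hy
  have h1 := ((C.coneFlattening_spec p).2.2.1.contDiffAt
    ((C.coneFlattening p).open_source.mem_nhds hy.2)).restrict_scalars ℝ
  exact (h1.comp (C.incl y) (C.contDiffAt_lift p.1 (q := C.incl y) hy.1)).snd

theorem fderiv_ambientChart {p y : C.N} (hy : y ∈ (C.holoChart p).source)
    (w : ℂ × EuclideanSpace ℝ (Fin (2 * l))) :
    fderiv ℝ (C.ambientChart p) (C.incl y) w =
      (fderiv ℂ (C.coneFlattening p) (C.lift p.1 (C.incl y))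
        (fderiv ℝ (C.lift p.1) (C.incl y) w)).2 := by
  rw [mem_holoChart_source_iff] at hy
  have h1 : HasFDerivAt (C.coneFlattening p) _ (C.lift p.1 (C.incl y)) :=
    (((C.coneFlattening_spec p).2.2.1.contDiffAt
    ((C.coneFlattening p).open_source.mem_nhds hy.2)).differentiableAt
      (by simp)).hasFDerivAt.restrictScalars ℝ
  have h2 := ((C.contDiffAt_lift p.1 (q := C.incl y) hy.1).differentiableAt (by simp)).hasFDerivAt
  have h3 : HasFDerivAt (C.ambientChart p) _ (C.incl y) := (h1.comp (C.incl y) h2).snd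
  rw [h3.fderiv]
  rfl

theorem chartDifferential_holoChart {p y : C.N} (hy : y ∈ (C.holoChart p).source)
    (v : TangentSpace C.modelN y) :
    chartDifferential (C.holoChart p) y v =
      fderiv ℝ (C.ambientChart p) (C.incl y) (C.dincl y v) := by
  have h1 : MDifferentiableAt 𝓘(ℝ, ℂ × EuclideanSpace ℝ (Fin (2 * l)))
      𝓘(ℝ, EuclideanSpace ℂ (Fin (l - 1))) (C.ambientChart p) (C.incl y) :=
    ((C.contDiffAt_ambientChart hy).differentiableAt (by simp)).mdifferentiableAt
  have h2 := (C.contMDiff_incl y).mdifferentiableAt (by simp)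
  have h3 := mfderiv_comp y h1 h2
  rw [mfderiv_eq_fderiv] at h3
  exact DFunLike.congr_fun h3 v

/-- The chart is the lift followed by holomorphic coordinates: the first differential turns `J` into
multiplication by `√-1`, and the second is complex linear. -/
theorem chartDifferential_holoChart_J
    {J : ∀ p : C.N, TangentSpace C.modelN p →L[ℝ] TangentSpace C.modelN p} (hJ : C.IsCliffordJ J)
    {p y : C.N} (hy : y ∈ (C.holoChart p).source) (v : TangentSpace C.modelN y) :
    chartDifferential (C.holoChart p) y (J y v) =
      Complex.I • chartDifferential (C.holoChart p) y v := by
  rw [isCliffordJ_iff] at hJ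
  rw [chartDifferential_holoChart C hy, chartDifferential_holoChart C hy, hJ,
    fderiv_ambientChart C hy, fderiv_ambientChart C hy,
    fderiv_lift_ambientJ C p.1 (C.mem_holoChart_source_iff.1 hy).1 (C.isTangent_dincl y v), map_smul]
  rfl

theorem contMDiffOn_holoChart (p : C.N) :
    ContMDiffOn C.modelN 𝓘(ℝ, EuclideanSpace ℂ (Fin (l - 1))) ω (C.holoChart p)
      (C.holoChart p).source := fun y hy =>
  ((C.contDiffAt_ambientChart hy).contMDiffAt.comp y (C.contMDiff_incl y)).contMDiffWithinAt

/-- With `w` the analytic point of the cone over `k`, the components are `exp(√-1 log |w|)`, rotated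
by the base point, and `w / |w|`. Both are analytic because `w` never vanishes. -/
theorem contMDiffOn_holoChart_symm (p : C.N) :
    ContMDiffOn 𝓘(ℝ, EuclideanSpace ℂ (Fin (l - 1))) C.modelN ω (C.holoChart p).symm
      (C.holoChart p).target := by
  intro k hk
  set e := C.coneFlattening p
  have h1 : ContDiffAt ℝ ω (fun k => C.coord (e.symm (0, k))) k := by
    have h2 := ((C.coneFlattening_spec p).2.2.2.contDiffAt
      (e.open_target.mem_nhds (C.mem_coneFlattening_target hk))).restrict_scalars ℝ
    exact C.coord.contDiff.contDiffAt.comp k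
      (h2.comp k (contDiff_const.prodMk contDiff_id).contDiffAt)
  have h0 : C.coord (e.symm (0, k)) ≠ 0 := by
    have h2 := C.lift_ne_zero p.1 ((C.holoChart p).symm k)
    rw [C.lift_holoChart_symm hk] at h2
    simpa using h2
  have h2 : ContMDiffWithinAt 𝓘(ℝ, EuclideanSpace ℂ (Fin (l - 1))) (𝓡 1) ω
      (fun k => p.1 * Circle.exp (Real.log ‖C.coord (e.symm (0, k))‖))
      (C.holoChart p).target k := by
    have h3 : ContDiffAt ℝ ω (fun k => Real.log ‖C.coord (e.symm (0, k))‖) k :=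
      (h1.norm ℝ h0).log (norm_ne_zero_iff.2 h0)
    exact (contMDiffAt_const.mul
      (contMDiff_circleExp.contMDiffAt.comp k h3.contMDiffAt)).contMDiffWithinAt
  have h3 : ContMDiffWithinAt 𝓘(ℝ, EuclideanSpace ℂ (Fin (l - 1)))
      𝓘(ℝ, EuclideanSpace ℝ (Fin (2 * l))) ω
      (fun k => (((C.holoChart p).symm k).2 : EuclideanSpace ℝ (Fin (2 * l))))
      (C.holoChart p).target k := by
    have h4 : ContDiffAt ℝ ω (fun k => ‖C.coord (e.symm (0, k))‖⁻¹ • C.coord (e.symm (0, k))) k :=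
      ((h1.norm ℝ h0).inv (norm_ne_zero_iff.2 h0)).smul h1
    refine h4.contMDiffAt.contMDiffWithinAt.congr_of_mem (fun k' hk' => ?_) hk
    have h5 := C.coneChart_symm_mem hk'
    have h6 := C.coe_radial p.2 (C.ne_zero_of_lt_norm_coord h5.1)
    rw [C.coe_coneChart_symm hk'] at h6
    exact h6
  refine ContMDiffWithinAt.prodMk (f := fun k => ((C.holoChart p).symm k).1)
    (g := fun k => ((C.holoChart p).symm k).2) ?_ (C.contMDiffWithinAt_focal h3)
  refine h2.congr_of_mem (fun k' hk' => ?_) hk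
  have h4 := C.coe_coneChart_symm hk'
  change p.1 * Circle.exp (Real.log ‖C.coord ((C.coneChart p).symm k')‖) = _
  rw [h4]

/-- The difference `δ` of two branches of the angle is continuous and satisfies `e^{√-1 δ} = a / b`,
so it is locally constant. -/
theorem eventually_lift_eq_smul {a b : Circle} {y : C.N} (ha : (y.1 / a : ℂ) ∈ Complex.slitPlane)
    (hb : (y.1 / b : ℂ) ∈ Complex.slitPlane) :
    ∃ c : ℝ, ∀ᶠ y' in 𝓝 y, C.lift b (C.incl y') = c • C.lift a (C.incl y') := by
  set δ : C.N → ℝ := fun y' => Complex.arg (y'.1 / b) - Complex.arg (y'.1 / a) with hδ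
  have hcont : ContinuousAt δ y := by
    have h1 : ∀ a : Circle, ContinuousAt (fun y' : C.N => (y'.1 / a : ℂ)) y := fun a => by fun_prop
    exact (ContinuousAt.comp (f := fun y' : C.N => (y'.1 / b : ℂ))
        (Complex.continuousAt_arg hb) (h1 b)).sub
      (ContinuousAt.comp (f := fun y' : C.N => (y'.1 / a : ℂ))
        (Complex.continuousAt_arg ha) (h1 a))
  have hexp : ∀ y', Circle.exp (δ y') = a / b := fun y' => by
    rw [hδ, Circle.exp_sub, ← Circle.coe_div, ← Circle.coe_div, Circle.exp_arg, Circle.exp_arg,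
      div_div_div_cancel_left]
  refine ⟨Real.exp (δ y), ?_⟩
  -- Values of `δ` differ by integer multiples of `2π`, so those at distance less than `2π`
  -- coincide.
  filter_upwards [hcont.eventually (Metric.ball_mem_nhds (δ y) Real.two_pi_pos)] with y' hy'
  have h1 : δ y' = δ y := by
    obtain ⟨m, hm⟩ := Circle.exp_eq_exp.1 ((hexp y').trans (hexp y).symm)
    rw [Real.dist_eq, hm, add_sub_cancel_left, abs_mul,
      abs_of_pos Real.two_pi_pos] at hy'
    have h2 : |(m : ℝ)| < 1 := by
      have := Real.two_pi_pos
      nlinarith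
    have h3 : m = 0 := by
      rw [← Int.abs_lt_one_iff]
      exact_mod_cast h2
    rw [hm, h3]; simp
  rw [← h1, lift, lift, smul_smul, ← Real.exp_add]
  congr 2
  simp [hδ, incl]

/-- On the cone, passing from one branch to the other is locally multiplication by a constant, which
is holomorphic; the transition sandwiches this between two holomorphic coordinate systems. -/
theorem contDiffOn_holoChart_transition (p p' : C.N) :
    ContDiffOn ℂ ω (C.holoChart p' ∘ (C.holoChart p).symm)
      ((C.holoChart p).symm.trans (C.holoChart p')).source := by
  intro k hk
  rw [OpenPartialHomeomorph.trans_source] at hk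
  have hk1 : k ∈ (C.holoChart p).target := hk.1
  have hk2 : (C.holoChart p).symm k ∈ (C.holoChart p').source := hk.2
  have hy := (C.holoChart p).map_target hk1
  obtain ⟨c, hc⟩ := C.eventually_lift_eq_smul (C.mem_holoChart_source_iff.1 hy).1
    (C.mem_holoChart_source_iff.1 hk2).1
  have hc' := ((C.holoChart p).continuousAt_symm hk1).eventually hc
  have h1 := (C.coneFlattening_spec p).2.2.2.contDiffAt
    ((C.coneFlattening p).open_target.mem_nhds (C.mem_coneFlattening_target hk1))
  have h2 : ContDiffAt ℂ ω (fun k => (c : ℂ) • (C.coneFlattening p).symm (0, k)) k :=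
    (contDiff_const_smul (c : ℂ)).contDiffAt.comp k
      (h1.comp k (contDiff_const.prodMk contDiff_id).contDiffAt)
  have h3 : ∀ᶠ k' in 𝓝 k, C.lift p'.1 (C.incl ((C.holoChart p).symm k')) =
      (c : ℂ) • (C.coneFlattening p).symm (0, k') := by
    filter_upwards [hc', (C.holoChart p).open_target.mem_nhds hk1] with k' hk' hkt
    rw [hk', C.lift_holoChart_symm hkt]
    rfl
  have h4 : ContDiffAt ℂ ω (C.coneFlattening p') ((c : ℂ) • (C.coneFlattening p).symm (0, k)) := by
    rw [← h3.self_of_nhds]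
    exact (C.coneFlattening_spec p').2.2.1.contDiffAt
      ((C.coneFlattening p').open_source.mem_nhds (C.mem_holoChart_source_iff.1 hk2).2)
  have h5 := (h4.comp k h2).snd
  refine (h5.congr_of_eventuallyEq ?_).contDiffWithinAt
  filter_upwards [h3] with k' hk'
  simp only [Function.comp_apply, holoChart_eq, ambientChart]
  rw [hk']

/-- The complex manifold structure of `S¹ × M_+`. -/
@[reducible]
def holoChartedSpace : ChartedSpace (EuclideanSpace ℂ (Fin (l - 1))) C.N where
  atlas := Set.range C.holoChart
  chartAt := C.holoChart
  mem_chart_source := C.mem_holoChart_source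
  chart_mem_atlas p := ⟨p, rfl⟩

theorem isManifold_holo :
    letI := C.holoChartedSpace
    IsManifold 𝓘(ℂ, EuclideanSpace ℂ (Fin (l - 1))) ω C.N := by
  let := C.holoChartedSpace
  apply isManifold_of_contDiffOn
  rintro _ _ ⟨p, rfl⟩ ⟨p', rfl⟩
  simp only [modelWithCornersSelf_coe, modelWithCornersSelf_coe_symm, Set.range_id, Set.inter_univ,
    Set.preimage_id_eq, id_eq, Function.comp_id, Function.id_comp]
  exact C.contDiffOn_holoChart_transition p p'

theorem isIntegrable
    {J : ∀ p : C.N, TangentSpace C.modelN p →L[ℝ] TangentSpace C.modelN p} (hJ : C.IsCliffordJ J) :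
    IsIntegrable C.modelN (l - 1) J := by
  refine ⟨C.holoChartedSpace, C.isManifold_holo, ?_⟩
  rintro _ ⟨p, rfl⟩
  exact ⟨(C.contMDiffOn_holoChart p).of_le le_top, (C.contMDiffOn_holoChart_symm p).of_le le_top,
    fun y hy v => C.chartDifferential_holoChart_J hJ hy v⟩

/-! ### Smoothness of `J` and the Hermitian metric -/

theorem isAlmostComplex
    {J : ∀ p : C.N, TangentSpace C.modelN p →L[ℝ] TangentSpace C.modelN p} (hJ : C.IsCliffordJ J) :
    IsAlmostComplex C.modelN J := by
  rw [isCliffordJ_iff] at hJ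
  refine ⟨?_, fun p v => ?_⟩
  · exact Immersion.contMDiff_section_of_intertwines (C.contMDiff_incl.of_le le_top)
      C.dincl_injective
      (C.contDiff_ambientJ.contMDiff.comp (C.contMDiff_incl.of_le le_top)) hJ
  · apply C.dincl_injective p
    rw [hJ, hJ, (C.isTangent_dincl p v).ambientJ_ambientJ, map_neg]

/-- The Euclidean bilinear form of `ℂ × ℝ^{2l}`. -/
def ambientInner (l : ℕ) : ℂ × EuclideanSpace ℝ (Fin (2 * l)) →L[ℝ]
    ℂ × EuclideanSpace ℝ (Fin (2 * l)) →L[ℝ] ℝ :=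
  (innerSL ℝ : ℂ →L[ℝ] ℂ →L[ℝ] ℝ).bilinearComp
      (ContinuousLinearMap.fst ℝ ℂ (EuclideanSpace ℝ (Fin (2 * l))))
      (ContinuousLinearMap.fst ℝ ℂ (EuclideanSpace ℝ (Fin (2 * l)))) +
    (innerSL ℝ : EuclideanSpace ℝ (Fin (2 * l)) →L[ℝ]
        EuclideanSpace ℝ (Fin (2 * l)) →L[ℝ] ℝ).bilinearComp
      (ContinuousLinearMap.snd ℝ ℂ (EuclideanSpace ℝ (Fin (2 * l))))
      (ContinuousLinearMap.snd ℝ ℂ (EuclideanSpace ℝ (Fin (2 * l))))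

theorem ambientInner_apply (u v : ℂ × EuclideanSpace ℝ (Fin (2 * l))) :
    ambientInner l u v = inner ℝ u.1 v.1 + inner ℝ u.2 v.2 :=
  rfl

/-- The product `ℂ × ℝ^{2l}` carries the maximum norm, whose square is at most the sum of the two
squares; hence the constant `1`. -/
theorem norm_sq_le_ambientInner (u : ℂ × EuclideanSpace ℝ (Fin (2 * l))) :
    1 * ‖u‖ ^ 2 ≤ ambientInner l u u := by
  rw [ambientInner_apply, real_inner_self_eq_norm_sq, real_inner_self_eq_norm_sq, one_mul,
    Prod.norm_def]
  rcases max_cases ‖u.1‖ ‖u.2‖ with h | h <;> rw [h.1] <;>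
  nlinarith [sq_nonneg ‖u.1‖, sq_nonneg ‖u.2‖]

theorem exists_riemannianMetric :
    ∃ G : Bundle.ContMDiffRiemannianMetric C.modelN ∞ C.ModelN
      (fun p : C.N => TangentSpace C.modelN p),
      ∀ (p : C.N) (u v : TangentSpace C.modelN p), G.inner p u v = C.productMetric p u v :=
  ⟨Immersion.riemannianMetric (C.contMDiff_incl.of_le le_top) C.dincl_injective (ambientInner l)
    (fun u v => by rw [ambientInner_apply, ambientInner_apply, real_inner_comm,
      real_inner_comm v.2]) 1 one_pos norm_sq_le_ambientInner, fun _ _ _ => rfl⟩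

theorem isHermitian
    {J : ∀ p : C.N, TangentSpace C.modelN p →L[ℝ] TangentSpace C.modelN p} (hJ : C.IsCliffordJ J) :
    IsHermitian C.modelN (l - 1) J C.productMetric where
  almostComplex := C.isAlmostComplex hJ
  integrable := C.isIntegrable hJ
  metric := C.exists_riemannianMetric
  invariant p u v := by
    have h := (C.isCliffordJ_iff J).1 hJ p
    rw [productMetric, h, h]
    exact (C.isTangent_dincl p u).inner_ambientJ (C.isTangent_dincl p v)

end CliffordSystem

end

theorem theorem1 (l : ℕ) (C : CliffordSystem 1 l) :
    (∃! J : ∀ p : C.N, TangentSpace C.modelN p →L[ℝ] TangentSpace C.modelN p, C.IsCliffordJ J) ∧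
    ∀ J : ∀ p : C.N, TangentSpace C.modelN p →L[ℝ] TangentSpace C.modelN p, C.IsCliffordJ J →
      IsIntegrable C.modelN (l - 1) J ∧
      IsHermitian C.modelN (l - 1) J C.productMetric :=
  ⟨C.existsUnique_isCliffordJ, fun _ hJ => ⟨C.isIntegrable hJ, C.isHermitian hJ⟩⟩
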